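/- Let $d\in\mathbb N$ and let $H:\mathbb R^d_x\times\mathbb R^d_\xi\to\mathbb R$, $n_I,S_I:\mathbb R^d\to\mathbb R$ satisfy the following assumptions. (A1) For some $\sigma\in\mathbb R$, $H\in S^\sigma$, i.e. $H$ is $C^\infty$ and for all multi-indices $\alpha,\beta$ there is $C_{\alpha,\beta}$ with $|\partial_x^\alpha\partial_\xi^\beta H(x,\xi)|\le C_{\alpha,\beta}(1+|\xi|)^{\sigma-|\beta|}$ for all $x,\xi$; and for some $\varepsilon_0>0$ and every $\varepsilon\in(0,\varepsilon_0]$ the Weyl operator $H^W(x,\varepsilon D)u(x)=(2\pi)^{-d}\iint H(\tfrac{x+y}2,\varepsilon\xi)u(y)e^{i(x-y)\cdot\xi}\,dy\,d\xi$, defined on Schwartz functions, has a unique self-adjoint extension in $L^2(\mathbb R^d)$. (A2) $n_I\in L^1(\mathbb R^d)$, $n_I\ge0$ a.e., and $S_I\in W^{1,1}_{loc}(\mathbb R^d)$; a representative of the weak gradient $\nabla S_I$ is fixed. (A3) The Hamiltonian flow $F_t(x,\xi)=(\tilde x(t,x,\xi),\tilde\xi(t,x,\xi))$, defined by $\partial_t\tilde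 x=\nabla_\xi H(\tilde x,\tilde\xi)$, $\partial_t\tilde\xi=-\nabla_xH(\tilde x,\tilde\xi)$, $F_0=\mathrm{id}$, exists globally, and $F_t$ is continuously differentiable on $\mathbb R^{2d}$ for every $t\in\mathbb R$. Put $$f_{x,t}(\xi)=\tilde\xi(-t,x,\xi)-\nabla S_I(\tilde x(-t,x,\xi)),\quad \mathcal K(x,t)=\{\xi:f_{x,t}(\xi)=0\},\quad Df_{x,t}(\xi)=\det\frac{\partial f_{x,t}(\xi)}{\partial\xi}.$$ (A4) $\mathcal U\subseteq\mathbb R^d_x\times\mathbb R_t$ is open and $N\in\mathbb N$ is such that for every $(x,t)\in\mathcal U$ the set $\mathcal K(x,t)$ consists of exactly $N$ distinct points $v_1(x,t),\dots,v_N(x,t)$. Moreover, for each $t$, $f_{x,t}(\xi)$ is continuously differentiable in $(x,\xi)$ on $\{(x,\xi):(x,t)\in\mathcal U\}$. Assume that $\mathcal U$ is free of caustics: $\mathcal U\cap\mathcal C=\emptyset$, where $\mathcal C=\{(x,t):Df_{x,t}(\xi)=0\text{ for at least one }\xi\in\mathcal K(x,t)\}$. Let $S_1,\dots,S_N\in C^2(\mathcal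 U)$ be real-valued with $\nabla_xS_i=v_i$ on $\mathcal U$, and define on $\mathcal U$ $$n_i(x,t)=\frac{n_I(\tilde x(-t,x,\nabla_xS_i(x,t)))}{|Df_{x,t}(\nabla_xS_i(x,t))|},\qquad \psi^\varepsilon_{wkb}(x,t)=\sum_{i=1}^N\sqrt{n_i(x,t)}\,e^{iS_i(x,t)/\varepsilon}.$$ For functions $f$ on $\mathbb R^d$ let $$w^\varepsilon[f](x,\xi)=(2\pi)^{-d}\int_{\mathbb R^d}f(x-\varepsilon\tfrac z2)\,\overline{f(x+\varepsilon\tfrac z2)}\,e^{iz\cdot\xi}\,dz .$$ Let $\phi\in C_0^\infty(\mathbb R^d_x\times\mathbb R_t)$ be real-valued with $\operatorname{supp}\phi\subseteq\mathcal U$, and extend $\phi\psi^\varepsilon_{wkb}$ by $0$ outside $\mathcal U$. Then for every $t\in\mathbb R$ the family $\phi(\cdot,t)\psi^\varepsilon_{wkb}(\cdot,t)$ is bounded in $L^2(\mathbb R^d)$ as $\varepsilon\to0^+$ and $$w^\varepsilon[\phi(\cdot,t)\,\psi^\varepsilon_{wkb}(\cdot,t)]\;\longrightarrow\;w_\phi(t)=\phi(x,t)^2\sum_{i=1}^N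 n_i(x,t)\,\delta(\xi-\nabla_xS_i(x,t))\,dx\qquad\text{in }\mathcal S'(\mathbb R^d_x\times\mathbb R^d_\xi)\quad(\varepsilon\to0^+),$$ where $w_\phi(t)$ is a finite positive measure; it is the only Wigner measure of the family: if, along some sequence $\varepsilon_k\to0^+$, these Wigner transforms converge in $\mathcal S'$ to a finite positive measure $\mu$, then $\mu=w_\phi(t)$. -/

import Mathlib

open MeasureTheory Filter Topology Set
open scoped ContDiff SchwartzMap InnerProductSpace ENNReal

noncomputable section

namespace WignerWKB

/-- Position space (and momentum space): `ℝ^d` with its Euclidean norm. -/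
abbrev Sp (d : ℕ) : Type := EuclideanSpace ℝ (Fin d)

variable {d : ℕ}

/-! ### The Hamiltonian symbol and its Weyl quantization -/

/-- The symbol class `S^σ`: `H` is smooth and, for all multi-indices `α`, `β`,
`|∂_x^α ∂_ξ^β H(x, ξ)| ≤ C_{α,β} (1 + |ξ|)^(σ - |β|)`. The multi-indices are given as finite
lists `a`, `b` of coordinates, of lengths `j = |α|` and `k = |β|`. -/
def IsSymbol (σ : ℝ) (H : Sp d → Sp d → ℝ) : Prop :=
  ContDiff ℝ ∞ (fun p : Sp d × Sp d => H p.1 p.2) ∧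
  ∀ (j k : ℕ) (a : Fin j → Fin d) (b : Fin k → Fin d), ∃ C : ℝ, ∀ x ξ : Sp d,
    |iteratedFDeriv ℝ (j + k) (fun p : Sp d × Sp d => H p.1 p.2) (x, ξ)
        (Fin.append
          (fun i => ((EuclideanSpace.single (a i) (1 : ℝ) : Sp d), (0 : Sp d)))
          (fun i => ((0 : Sp d), (EuclideanSpace.single (b i) (1 : ℝ) : Sp d))))|
      ≤ C * (1 + ‖ξ‖) ^ (σ - (k : ℝ))

/-- Weyl quantization
`H^W(x, εD) u (x) = (2π)^(-d) ∫ ∫ H((x + y)/2, εξ) u(y) e^{i (x - y)·ξ} dy dξ`.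
For a symbol `H` of class `S^σ` and a Schwartz function `u` the inner integral converges
absolutely and decreases rapidly in `ξ`, so this is the usual oscillatory integral. -/
def weylOp (H : Sp d → Sp d → ℝ) (ε : ℝ) (u : Sp d → ℂ) (x : Sp d) : ℂ :=
  (((2 * Real.pi) ^ d)⁻¹ : ℝ) *
    ∫ ξ : Sp d, ∫ y : Sp d,
      (H ((1 / 2 : ℝ) • (x + y)) (ε • ξ) : ℂ) * u y *
        Complex.exp (Complex.I * ((⟪x - y, ξ⟫_ℝ : ℝ) : ℂ))

/-- The operator `H^W(x, εD)`, defined on Schwartz functions, has exactly one self-adjoint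
extension in `L²(ℝ^d; ℂ)`. (Then `i H^W(x, εD)` has a unique anti-self-adjoint extension.) -/
def HasUniqueSelfAdjointExtension (H : Sp d → Sp d → ℝ) (ε : ℝ) : Prop :=
  ∃! A : Lp ℂ 2 (volume : Measure (Sp d)) →ₗ.[ℂ] Lp ℂ 2 (volume : Measure (Sp d)),
    IsSelfAdjoint A ∧
    ∀ u : 𝓢(Sp d, ℂ), ∃ h : u.toLp 2 volume ∈ A.domain,
      (A ⟨u.toLp 2 volume, h⟩ : Sp d → ℂ) =ᵐ[volume] weylOp H ε u

/-- `F` is the global Hamiltonian flow of `H`, `F t (x, ξ) = (x̃(t,x,ξ), ξ̃(t,x,ξ))`, where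
`∂_t x̃ = ∇_ξ H(x̃, ξ̃)`, `∂_t ξ̃ = -∇_x H(x̃, ξ̃)`, `(x̃, ξ̃)(0, x, ξ) = (x, ξ)`, and every
`F t` is continuously differentiable. -/
structure IsHamiltonianFlow (H : Sp d → Sp d → ℝ) (F : ℝ → Sp d × Sp d → Sp d × Sp d) :
    Prop where
  zero : ∀ p, F 0 p = p
  hamilton : ∀ t p, HasDerivAt (fun s => F s p)
    (gradient (fun η => H (F t p).1 η) (F t p).2,
      -gradient (fun y => H y (F t p).2) (F t p).1) t
  contDiff : ∀ t, ContDiff ℝ 1 (F t)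

/-! ### The initial phase -/

/-- `S ∈ W^{1,1}_loc(ℝ^d)` with weak gradient `g`. -/
structure IsWeakGradient (S : Sp d → ℝ) (g : Sp d → Sp d) : Prop where
  locallyIntegrable : LocallyIntegrable S volume
  locallyIntegrable_grad : LocallyIntegrable g volume
  integral_eq : ∀ χ : Sp d → ℝ, ContDiff ℝ ∞ χ → HasCompactSupport χ → ∀ v : Sp d,
    ∫ x, S x * fderiv ℝ χ x v = -∫ x, ⟪g x, v⟫_ℝ * χ x

/-! ### Branches and caustics; `g` stands for `∇ S_I` -/

/-- `f_{x,t}(ξ) = ξ̃(-t,x,ξ) - ∇S_I(x̃(-t,x,ξ))`. -/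
def branchMap (F : ℝ → Sp d × Sp d → Sp d × Sp d) (g : Sp d → Sp d)
    (x : Sp d) (t : ℝ) (ξ : Sp d) : Sp d :=
  (F (-t) (x, ξ)).2 - g (F (-t) (x, ξ)).1

/-- The nullset `𝒦(x,t)` of `f_{x,t}`. -/
def nullset (F : ℝ → Sp d × Sp d → Sp d × Sp d) (g : Sp d → Sp d)
    (x : Sp d) (t : ℝ) : Set (Sp d) :=
  {ξ | branchMap F g x t ξ = 0}

/-- The functional determinant `Df_{x,t}(ξ) = det (∂f_{x,t}(ξ)/∂ξ)`. -/
def branchDet (F : ℝ → Sp d × Sp d → Sp d × Sp d) (g : Sp d → Sp d)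
    (x : Sp d) (t : ℝ) (ξ : Sp d) : ℝ :=
  (fderiv ℝ (branchMap F g x t) ξ).det

/-- The caustic set: points `(x,t)` such that `Df_{x,t}` vanishes somewhere on `𝒦(x,t)`. -/
def causticSet (F : ℝ → Sp d × Sp d → Sp d × Sp d) (g : Sp d → Sp d) : Set (Sp d × ℝ) :=
  {p | ∃ ξ ∈ nullset F g p.1 p.2, branchDet F g p.1 p.2 ξ = 0}

/-- `n_I(x̃(-t,x,ξ)) / |Df_{x,t}(ξ)|`; with `ξ = ∇_x S_i(x,t)` this is the density `n_i(x,t)`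
of the `i`-th branch. -/
def branchDensity (F : ℝ → Sp d × Sp d → Sp d × Sp d) (g : Sp d → Sp d) (nI : Sp d → ℝ)
    (x : Sp d) (t : ℝ) (ξ : Sp d) : ℝ :=
  nI (F (-t) (x, ξ)).1 / |branchDet F g x t ξ|

/-- The gradient `∇_x S(x,t)` in the position variable only. -/
def gradX (S : Sp d → ℝ → ℝ) (x : Sp d) (t : ℝ) : Sp d :=
  gradient (fun y => S y t) x

/-- The multiphase WKB function `ψ^ε(x,t) = ∑_i √(n_i(x,t)) exp(i S_i(x,t) / ε)`. -/
def psiWKB (F : ℝ → Sp d × Sp d → Sp d × Sp d) (g : Sp d → Sp d) (nI : Sp d → ℝ)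
    {N : ℕ} (S : Fin N → Sp d → ℝ → ℝ) (ε : ℝ) (x : Sp d) (t : ℝ) : ℂ :=
  ∑ i, (Real.sqrt (branchDensity F g nI x t (gradX (S i) x t)) : ℂ) *
    Complex.exp (Complex.I / (ε : ℂ) * (S i x t : ℂ))

/-- The multiphase measure `∑_i n_i(x,t) δ(ξ - ∇_x S_i(x,t)) dx` at time `t`, over the time
slice `{x | (x,t) ∈ U}`. -/
def multiphaseMeasure (F : ℝ → Sp d × Sp d → Sp d × Sp d) (g : Sp d → Sp d) (nI : Sp d → ℝ)
    (U : Set (Sp d × ℝ)) {N : ℕ} (S : Fin N → Sp d → ℝ → ℝ) (t : ℝ) :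
    Measure (Sp d × Sp d) :=
  ∑ i, ((volume.restrict {x : Sp d | (x, t) ∈ U}).withDensity
      (fun x => ENNReal.ofReal (branchDensity F g nI x t (gradX (S i) x t)))).map
    (fun x => (x, gradX (S i) x t))

/-! ### Wigner transform and Wigner measure -/

/-- The Wigner transform on the scale `ε`,
`w^ε(f,h)(x,ξ) = (2π)^(-d) ∫ f(x - εz/2) conj(h(x + εz/2)) e^{i z·ξ} dz`. -/
def wigner (ε : ℝ) (f h : Sp d → ℂ) (x ξ : Sp d) : ℂ :=
  (((2 * Real.pi) ^ d)⁻¹ : ℝ) *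
    ∫ z : Sp d, f (x - (ε / 2) • z) * (starRingEnd ℂ) (h (x + (ε / 2) • z)) *
      Complex.exp (Complex.I * ((⟪z, ξ⟫_ℝ : ℝ) : ℂ))

/-- The finite positive measure `μ` on phase space is the Wigner measure of the `L²`-bounded
family `f^ε` as `ε` tends to its limit along `l`: `w^ε[f^ε] → μ` in the space `𝓢'` of tempered
distributions on `ℝ^d_x × ℝ^d_ξ`. -/
structure IsWignerMeasure (l : Filter ℝ) (f : ℝ → Sp d → ℂ) (μ : Measure (Sp d × Sp d)) :
    Prop where
  finite : IsFiniteMeasure μ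
  memLp : ∀ᶠ ε in l, MemLp (f ε) 2 volume
  bounded : ∃ C : ℝ, ∀ᶠ ε in l, eLpNorm (f ε) 2 volume ≤ ENNReal.ofReal C
  tendsto : ∀ a : 𝓢(Sp d × Sp d, ℂ),
    Tendsto (fun ε => ∫ p : Sp d × Sp d, a p * wigner ε (f ε) (f ε) p.1 p.2) l
      (𝓝 (∫ p, a p ∂μ))

end WignerWKB

end

open WignerWKB

/-!
Fix `t` and let `V` be the time slice of `U`. Over `V` the branch `ξ = ∇S_i(x, t)` of the nullset
is the image under the flow of a piece of the graph of `g = ∇S_I`, and the foot map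
`x ↦ x̃(-t, x, ∇S_i)` has the differentiable left inverse `y ↦ (F_t(y, g(y)))₁`. It is therefore
injective with nonvanishing Jacobian, and the change of variables formula shows that the densities
`n_i` are locally integrable on `V` (`locallyIntegrableOn_branchDensity`). Here `g` need not be
smooth a priori; its differentiability at the feet is read off from that of `f_{x,t}(ξ)`
(`differentiableAt_foot`).

After multiplication by the cutoff, the WKB function is a finite sum `∑_j A_j e^{iS_j/ε}` with
`A_j ∈ L²` supported in a fixed compact set `K`, with phases that may be taken `C²` on the whole
space, and with gradients `∇S_j` pairwise distinct on `K`, because the points of the nullset are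
distinct. For such sums the limit is computed by hand (`tendsto_integral_mul_wigner_wkbSum`). By
Fubini, pairing the Wigner transform with a test function `a` gives
`(2π)^(-d) ∫∫ b(x, z) f(x - εz/2) conj f(x + εz/2) dx dz`, where `b` is the partial Fourier
transform of `a` in the momentum variable (`integral_mul_wigner`); `b` is bounded by an integrable
function of `z`, so it is enough to take the limit at fixed `z`. There, continuity of translations
in `L²` and differentiability of the phases show that the `(j, k)` term is an oscillatory integral
with a fixed `L¹` amplitude and phase `(S_j - S_k)/ε`, up to `o(1)` (`tendsto_correlation_sub`). For
`j ≠ k` the phase has no stationary points on `K` and the integral tends to zero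
(`tendsto_integral_mul_osc`, by integration by parts and density); for `j = k` the limit is
`∫ b(x, z) A_j² e^{-iz·∇S_j} dx`, and integrating over `z` undoes the partial Fourier transform.

Uniqueness holds because finite measures are determined by their integrals against Schwartz
functions (`ext_of_forall_integral_schwartz_eq`).
-/

namespace WignerWKB

variable {d : ℕ}

/-! ### The Hamiltonian flow -/

/-- The Hamiltonian vector field `(∇_ξ H, -∇_x H)` on phase space. -/
noncomputable def hamiltonianField (H : Sp d → Sp d → ℝ) (p : Sp d × Sp d) : Sp d × Sp d :=
  (gradient (fun η => H p.1 η) p.2, -gradient (fun y => H y p.2) p.1)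

theorem contDiff_hamiltonianField {H : Sp d → Sp d → ℝ}
    (hH : ContDiff ℝ ∞ (fun p : Sp d × Sp d => H p.1 p.2)) :
    ContDiff ℝ 1 (hamiltonianField H) := by
  have hd : Differentiable ℝ (fun p : Sp d × Sp d => H p.1 p.2) := hH.differentiable (by simp)
  have h1 : ContDiff ℝ 1 (fderiv ℝ (fun p : Sp d × Sp d => H p.1 p.2)) :=
    hH.fderiv_right (by
      rw [one_add_one_eq_two]; exact WithTop.coe_le_coe.2 le_top)
  have hξ : ∀ p : Sp d × Sp d, gradient (fun η => H p.1 η) p.2 =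
      (InnerProductSpace.toDual ℝ (Sp d)).symm
        ((fderiv ℝ (fun p : Sp d × Sp d => H p.1 p.2) p).comp
          (ContinuousLinearMap.inr ℝ (Sp d) (Sp d))) := fun p => by
    have := (hd p).hasFDerivAt.comp (f := fun η => (p.1, η)) p.2 (hasFDerivAt_prodMk_right p.1 p.2)
    rw [gradient, ← this.fderiv]
    rfl
  have hx : ∀ p : Sp d × Sp d, gradient (fun y => H y p.2) p.1 =
      (InnerProductSpace.toDual ℝ (Sp d)).symm
        ((fderiv ℝ (fun p : Sp d × Sp d => H p.1 p.2) p).comp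
          (ContinuousLinearMap.inl ℝ (Sp d) (Sp d))) := fun p => by
    have := (hd p).hasFDerivAt.comp (f := fun y => (y, p.2)) p.1 (hasFDerivAt_prodMk_left p.1 p.2)
    rw [gradient, ← this.fderiv]
    rfl
  have : hamiltonianField H = fun p => (_, -_) := funext fun p => by
    rw [hamiltonianField, hξ, hx]
  rw [this]
  exact ((InnerProductSpace.toDual ℝ (Sp d)).symm.contDiff.comp
    (h1.clm_comp contDiff_const)).prodMk
    ((InnerProductSpace.toDual ℝ (Sp d)).symm.contDiff.comp
    (h1.clm_comp contDiff_const)).neg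

/-- Global solutions of an autonomous equation with `C¹` right-hand side are determined by one
value. -/
theorem eq_of_hasDerivAt_of_contDiff {E : Type*} [NormedAddCommGroup E] [NormedSpace ℝ E]
    [FiniteDimensional ℝ E] {X : E → E} (hX : ContDiff ℝ 1 X) {γ₁ γ₂ : ℝ → E}
    (h₁ : ∀ s, HasDerivAt γ₁ (X (γ₁ s)) s) (h₂ : ∀ s, HasDerivAt γ₂ (X (γ₂ s)) s)
    {s₀ : ℝ} (h₀ : γ₁ s₀ = γ₂ s₀) : γ₁ = γ₂ := by
  have c₁ : Continuous γ₁ := continuous_iff_continuousAt.2 fun s => (h₁ s).continuousAt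
  have c₂ : Continuous γ₂ := continuous_iff_continuousAt.2 fun s => (h₂ s).continuousAt
  funext t
  set a := min s₀ t - 1
  set b := max s₀ t + 1
  -- both curves stay in a common ball over `[a, b]`, where `X` is Lipschitz
  obtain ⟨R, hR⟩ := ((isCompact_Icc.image c₁).union
    ((isCompact_Icc (a := a) (b := b)).image c₂)).isBounded.subset_closedBall (0 : E)
  obtain ⟨K, hK⟩ := hX.contDiffOn.exists_lipschitzOnWith one_ne_zero (convex_closedBall (0 : E) R)
    (isCompact_closedBall 0 R)
  refine ODE_solution_unique_of_mem_Icc (v := fun _ => X) (s := fun _ => Metric.closedBall 0 R)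
    (a := a) (b := b) (t₀ := s₀) (fun _ _ => hK) ?_ c₁.continuousOn (fun s _ => h₁ s)
    (fun s hs => hR (Or.inl ⟨s, Ioo_subset_Icc_self hs, rfl⟩)) c₂.continuousOn (fun s _ => h₂ s)
    (fun s hs => hR (Or.inr ⟨s, Ioo_subset_Icc_self hs, rfl⟩)) h₀ ?_
  · constructor <;> simp only [a, b] <;> grind
  · constructor <;> simp only [a, b] <;> grind

theorem IsHamiltonianFlow.apply_neg {H : Sp d → Sp d → ℝ}
    (hH : ContDiff ℝ ∞ (fun p : Sp d × Sp d => H p.1 p.2))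
    {F : ℝ → Sp d × Sp d → Sp d × Sp d} (hF : IsHamiltonianFlow H F) (t : ℝ) (p : Sp d × Sp d) :
    F t (F (-t) p) = p := by
  have h := eq_of_hasDerivAt_of_contDiff (contDiff_hamiltonianField hH)
    (γ₁ := fun s => F s (F (-t) p)) (γ₂ := fun s => F (s - t) p) (s₀ := 0)
    (fun s => hF.hamilton s _)
    (fun s => by
      have := (hF.hamilton (s - t) p).scomp s ((hasDerivAt_id s).sub_const t)
      rw [one_smul] at this
      exact this)
    (by simp [hF.zero])
  have := congrFun h t
  simpa [hF.zero] using this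

/-! ### Branches of the projected Lagrangian manifold -/

section Branch

variable {F : ℝ → Sp d × Sp d → Sp d × Sp d} {g : Sp d → Sp d} {t : ℝ} {V : Set (Sp d)}
  {w : Sp d → Sp d}

/-- Along a branch `ξ = w(x)` of the nullset, the flow maps `(y, g(y))`, where `y` is the foot
`x̃(-t, x, w(x))`, back to `(x, w(x))`. -/
theorem flow_foot (hFF : ∀ p, F t (F (-t) p) = p) (hw : ∀ x ∈ V, branchMap F g x t (w x) = 0)
    {x : Sp d} (hx : x ∈ V) :
    F t ((F (-t) (x, w x)).1, g (F (-t) (x, w x)).1) = (x, w x) := by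
  have h : g (F (-t) (x, w x)).1 = (F (-t) (x, w x)).2 := (sub_eq_zero.1 (hw x hx)).symm
  rw [h]
  exact hFF _

theorem injOn_foot (hFF : ∀ p, F t (F (-t) p) = p)
    (hw : ∀ x ∈ V, branchMap F g x t (w x) = 0) :
    InjOn (fun x => (F (-t) (x, w x)).1) V := by
  intro x hx y hy hxy
  have hxy' : (F (-t) (x, w x)).1 = (F (-t) (y, w y)).1 := hxy
  have h1 := flow_foot hFF hw hx
  rw [hxy', flow_foot hFF hw hy] at h1
  exact (congrArg Prod.fst h1).symm

/-- The gradient `g` of the initial phase is differentiable at every foot `x̃(-t, x, ξ)` over a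
point where `f_{x,t}(ξ)` is differentiable in `(x, ξ)`: in the coordinates
`(y, η) = F_{-t}(x, ξ)` the relation defining `f` reads `g(y) = η - f(F_t(y, η))`. -/
theorem differentiableAt_foot (hFF : ∀ p, F t (F (-t) p) = p) (hFF' : ∀ p, F (-t) (F t p) = p)
    (hFt : Differentiable ℝ (F t)) {x ξ : Sp d}
    (hf : DifferentiableAt ℝ (fun q : Sp d × Sp d => branchMap F g q.1 t q.2) (x, ξ)) :
    DifferentiableAt ℝ g (F (-t) (x, ξ)).1 := by
  set η := (F (-t) (x, ξ)).2
  have hg : g = fun y => η - branchMap F g (F t (y, η)).1 t (F t (y, η)).2 := by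
    funext y
    simp [branchMap, hFF']
  have h2 : DifferentiableAt ℝ (fun y => F t (y, η)) (F (-t) (x, ξ)).1 :=
    (hFt _).comp _ (by fun_prop)
  have h3 : F t ((F (-t) (x, ξ)).1, η) = (x, ξ) := hFF _
  rw [← h3] at hf
  rw [hg]
  exact (differentiableAt_const η).sub
    (hf.comp (f := fun y => F t (y, η)) (F (-t) (x, ξ)).1 h2)

/-- The foot map of a branch is a local diffeomorphism: `y ↦ (F_t(y, g(y)))₁` is a
differentiable left inverse. -/
theorem det_fderiv_foot_ne_zero (hV : IsOpen V) (hFF : ∀ p, F t (F (-t) p) = p)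
    (hFF' : ∀ p, F (-t) (F t p) = p) (hFt : Differentiable ℝ (F t))
    (hFt' : Differentiable ℝ (F (-t))) (hw : ∀ x ∈ V, branchMap F g x t (w x) = 0)
    (hwd : DifferentiableOn ℝ w V)
    (hf : ∀ x ∈ V, DifferentiableAt ℝ (fun q : Sp d × Sp d => branchMap F g q.1 t q.2) (x, w x))
    {x : Sp d} (hx : x ∈ V) :
    (fderiv ℝ (fun x => (F (-t) (x, w x)).1) x).det ≠ 0 := by
  set Φ : Sp d → Sp d := fun x => (F (-t) (x, w x)).1
  set R : Sp d → Sp d := fun y => (F t (y, g y)).1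
  have hΦ : DifferentiableAt ℝ Φ x :=
    ((hFt' _).comp x (differentiableAt_id.prodMk (hwd.differentiableAt (hV.mem_nhds hx)))).fst
  have hR : DifferentiableAt ℝ R (Φ x) :=
    ((hFt _).comp (Φ x) (differentiableAt_id.prodMk
      (differentiableAt_foot hFF hFF' hFt (hf x hx)))).fst
  have hRΦ : R ∘ Φ =ᶠ[𝓝 x] id := by
    filter_upwards [hV.mem_nhds hx] with y hy
    exact congrArg Prod.fst (flow_foot hFF hw hy)
  have h := (hR.hasFDerivAt.comp x hΦ.hasFDerivAt).unique
    ((hasFDerivAt_id x).congr_of_eventuallyEq hRΦ)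
  have h2 := congrArg ContinuousLinearMap.det h
  rw [ContinuousLinearMap.det, ContinuousLinearMap.toLinearMap_comp, LinearMap.det_comp] at h2
  intro h0
  rw [ContinuousLinearMap.det] at h0
  rw [h0, mul_zero] at h2
  simp [ContinuousLinearMap.det] at h2

theorem contDiffOn_foot (hFt' : ContDiff ℝ 1 (F (-t))) (hwd : ContDiffOn ℝ 1 w V) :
    ContDiffOn ℝ 1 (fun x => (F (-t) (x, w x)).1) V :=
  contDiff_fst.comp_contDiffOn (hFt'.comp_contDiffOn (contDiffOn_id.prodMk hwd))

/-- Over a branch without caustics, the transported density `n_I(x̃(-t, x, w)) / |Df|` is locally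
integrable: the foot map changes Lebesgue measure by a factor bounded above and below on compact
sets. -/
theorem locallyIntegrableOn_branchDensity {nI : Sp d → ℝ} (hnI : Integrable nI volume)
    (hV : IsOpen V) (hFF : ∀ p, F t (F (-t) p) = p)
    (hFF' : ∀ p, F (-t) (F t p) = p) (hFt : Differentiable ℝ (F t))
    (hFt' : ContDiff ℝ 1 (F (-t))) (hw : ∀ x ∈ V, branchMap F g x t (w x) = 0)
    (hwd : ContDiffOn ℝ 1 w V)
    (hf : ContDiffOn ℝ 1 (fun q : Sp d × Sp d => branchMap F g q.1 t q.2) {q | q.1 ∈ V})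
    (hdet : ∀ x ∈ V, branchDet F g x t (w x) ≠ 0) :
    LocallyIntegrableOn (fun x => branchDensity F g nI x t (w x)) V volume := by
  set Φ : Sp d → Sp d := fun x => (F (-t) (x, w x)).1
  have hVV : IsOpen {q : Sp d × Sp d | q.1 ∈ V} := hV.preimage continuous_fst
  have hfd : ∀ q ∈ {q : Sp d × Sp d | q.1 ∈ V},
      DifferentiableAt ℝ (fun q : Sp d × Sp d => branchMap F g q.1 t q.2) q := fun q hq =>
    (hf.differentiableOn one_ne_zero).differentiableAt (hVV.mem_nhds hq)
  have hΦ : ContDiffOn ℝ 1 Φ V := contDiffOn_foot hFt' hwd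
  have hΦd : ∀ x ∈ V, HasFDerivWithinAt Φ (fderiv ℝ Φ x) V x := fun x hx =>
    ((hΦ.differentiableOn one_ne_zero).differentiableAt
      (hV.mem_nhds hx)).hasFDerivAt.hasFDerivWithinAt
  have hΦ0 : ∀ x ∈ V, (fderiv ℝ Φ x).det ≠ 0 := fun x hx =>
    det_fderiv_foot_ne_zero hV hFF hFF' hFt (hFt'.differentiable one_ne_zero) hw
      (hwd.differentiableOn one_ne_zero) (fun x hx => hfd (x, w x) hx) hx
  have hint : IntegrableOn (fun x => |(fderiv ℝ Φ x).det| • nI (Φ x)) V volume :=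
    (integrableOn_image_iff_integrableOn_abs_det_fderiv_smul volume hV.measurableSet hΦd
      (injOn_foot hFF hw) nI).1 hnI.integrableOn
  have hc1 : ContinuousOn (fun x => (fderiv ℝ Φ x).det) V :=
    ContinuousLinearMap.continuous_det.comp_continuousOn
      (hΦ.continuousOn_fderiv_of_isOpen hV le_rfl)
  have hbd : ∀ x ∈ V, branchDet F g x t (w x) =
      ((fderiv ℝ (fun q : Sp d × Sp d => branchMap F g q.1 t q.2) (x, w x)).comp
        (ContinuousLinearMap.inr ℝ (Sp d) (Sp d))).det := fun x hx => by
    have := (hfd (x, w x) hx).hasFDerivAt.comp (f := fun η => (x, η)) (w x)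
      (hasFDerivAt_prodMk_right x (w x))
    rw [branchDet, ← this.fderiv]
    rfl
  have hc2 : ContinuousOn (fun x => branchDet F g x t (w x)) V := by
    refine ContinuousOn.congr ?_ hbd
    refine ContinuousLinearMap.continuous_det.comp_continuousOn (ContinuousOn.clm_comp ?_
      continuousOn_const)
    exact (hf.continuousOn_fderiv_of_isOpen hVV le_rfl).comp
      (continuousOn_id.prodMk hwd.continuousOn) (fun x hx => hx)
  have hc : ContinuousOn
      (fun x => |(fderiv ℝ Φ x).det|⁻¹ * |branchDet F g x t (w x)|⁻¹) V :=
    (hc1.abs.inv₀ fun x hx => abs_ne_zero.2 (hΦ0 x hx)).mul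
      (hc2.abs.inv₀ fun x hx => abs_ne_zero.2 (hdet x hx))
  have hloc := (hint.locallyIntegrableOn).continuousOn_mul hc hV.isLocallyClosed
  rw [locallyIntegrableOn_iff hV.isLocallyClosed] at hloc ⊢
  intro k hk hkc
  refine (hloc k hk hkc).congr_fun (fun x hx => ?_) hkc.measurableSet
  have := abs_ne_zero.2 (hΦ0 x (hk hx))
  change _ = nI (Φ x) / |branchDet F g x t (w x)|
  simp only [smul_eq_mul]
  field_simp

end Branch

/-! ### Oscillatory integrals without stationary points -/

section NonStationary

variable {E : Type*} [NormedAddCommGroup E] [InnerProductSpace ℝ E] [FiniteDimensional ℝ E]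

theorem exists_contDiff_cutoff {K V : Set E} (hK : IsClosed K) (hV : IsOpen V) (hKV : K ⊆ V) :
    ∃ χ : E → ℝ, ContDiff ℝ ∞ χ ∧ (∀ᶠ x in 𝓝ˢ K, χ x = 1) ∧ tsupport χ ⊆ V ∧
      ∀ x, χ x ∈ Icc (0 : ℝ) 1 := by
  obtain ⟨χ, h0, h1, h⟩ := exists_contMDiffMap_zero_one_nhds_of_isClosed (modelWithCornersSelf ℝ E)
    hV.isClosed_compl hK (disjoint_compl_left_iff_subset.2 hKV) (n := ⊤)
  refine ⟨χ, χ.contMDiff.contDiff, h1, fun x hx => ?_, h⟩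
  by_contra hxV
  exact (notMem_tsupport_iff_eventuallyEq.2 (eventually_nhdsSet_iff_forall.1 h0 x hxV)) hx

variable [MeasurableSpace E] [BorelSpace E]

theorem integral_fderiv_eq_zero_of_hasCompactSupport {u : E → ℂ} (hu : ContDiff ℝ 1 u)
    (hc : HasCompactSupport u) (v : E) : ∫ x, fderiv ℝ u x v = 0 := by
  have hc' : HasCompactSupport (fun x => fderiv ℝ u x v) := hc.fderiv_apply (𝕜 := ℝ) v
  have hi : Integrable (fun x => fderiv ℝ u x v) (volume : Measure E) :=
    ((hu.continuous_fderiv one_ne_zero).clm_apply continuous_const).integrable_of_hasCompactSupport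
      hc'
  have h := integral_mul_fderiv_eq_neg_fderiv_mul_of_integrable (𝕜 := ℂ) (μ := (volume : Measure E))
    (f := fun _ => (1 : ℂ)) (g := u) (v := v) (by simp) (by simpa using hi)
    (by simpa using hu.continuous.integrable_of_hasCompactSupport hc)
    (fun x _ => differentiableAt_const _) (fun x _ => hu.differentiable one_ne_zero x)
  simpa using h

/-- The oscillating factor `e^{iσ/ε}`. -/
noncomputable def osc (ε s : ℝ) : ℂ := Complex.exp (Complex.I / (ε : ℂ) * (s : ℂ))

@[simp] theorem norm_osc (ε s : ℝ) : ‖osc ε s‖ = 1 := by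
  rw [osc, Complex.norm_exp]
  simp [Complex.div_re, Complex.mul_re]

theorem contDiff_osc (ε : ℝ) {n : WithTop ℕ∞} : ContDiff ℝ n (osc ε) := by
  unfold osc
  exact (contDiff_const.mul Complex.ofRealCLM.contDiff).cexp

theorem continuous_osc (ε : ℝ) : Continuous (osc ε) := (contDiff_osc ε (n := 0)).continuous

theorem hasDerivAt_osc (ε s : ℝ) : HasDerivAt (osc ε) (osc ε s * (Complex.I / ε)) s := by
  unfold osc
  have := ((Complex.ofRealCLM.hasDerivAt (x := s)).const_mul (Complex.I / (ε : ℂ))).cexp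
  simpa using this

/-- Nonstationary phase for a `C¹` amplitude: one integration by parts along the field
`∇σ / |∇σ|²` gains a factor `ε`. -/
theorem exists_norm_integral_mul_osc_le {σ : E → ℝ} (hσ : ContDiff ℝ 2 σ) {c : E → ℂ}
    (hc : ContDiff ℝ 1 c) (hcs : HasCompactSupport c) (hne : ∀ x ∈ tsupport c, fderiv ℝ σ x ≠ 0) :
    ∃ C : ℝ, ∀ ε : ℝ, 0 < ε → ‖∫ x, c x * osc ε (σ x)‖ ≤ ε * C := by
  set b := stdOrthonormalBasis ℝ E
  set q : E → ℝ := fun x => ∑ l, (fderiv ℝ σ x (b l)) ^ 2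
  have hD : ∀ l, ContDiff ℝ 1 (fun x => fderiv ℝ σ x (b l)) := fun l =>
    (hσ.fderiv_right (by norm_num [one_add_one_eq_two])).clm_apply contDiff_const
  have hq : ContDiff ℝ 1 q := ContDiff.sum fun l _ => (hD l).pow 2
  have hq0 : ∀ x, fderiv ℝ σ x ≠ 0 → q x ≠ 0 := fun x hx h => hx <| by
    have h' := (Finset.sum_eq_zero_iff_of_nonneg (fun l _ => sq_nonneg _)).1 h
    have := b.toBasis.ext (f₁ := (fderiv ℝ σ x).toLinearMap) (f₂ := 0) fun l => by
      simpa using h' l (Finset.mem_univ l)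
    exact ContinuousLinearMap.coe_injective this
  -- the components of `c ∇σ / |∇σ|²`, whose inner product with `∇σ` is `c`
  set a : Fin (Module.finrank ℝ E) → E → ℂ :=
    fun l x => c x * ((fderiv ℝ σ x (b l) / q x : ℝ) : ℂ)
  have ha : ∀ l, ContDiff ℝ 1 (a l) := fun l => contDiff_iff_contDiffAt.2 fun x => by
    by_cases hx : x ∈ tsupport c
    · exact hc.contDiffAt.mul (Complex.ofRealCLM.contDiff.contDiffAt.comp x
        ((hD l).contDiffAt.div hq.contDiffAt (hq0 x (hne x hx))))
    · refine contDiffAt_const (c := (0 : ℂ)) |>.congr_of_eventuallyEq ?_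
      filter_upwards [notMem_tsupport_iff_eventuallyEq.1 hx] with y hy
      simp [a, hy]
  have has : ∀ l, HasCompactSupport (a l) := fun l => hcs.mul_right
  have hsum : ∀ x, ∑ l, a l x * (fderiv ℝ σ x (b l) : ℂ) = c x := fun x => by
    by_cases hx : x ∈ tsupport c
    · have h0 : (q x : ℂ) ≠ 0 := by exact_mod_cast hq0 x (hne x hx)
      have : ∀ l, a l x * (fderiv ℝ σ x (b l) : ℂ) =
          c x / q x * (((fderiv ℝ σ x (b l)) ^ 2 : ℝ) : ℂ) := fun l => by
        simp only [a]; push_cast; ring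
      simp_rw [this]
      rw [← Finset.mul_sum, ← Complex.ofReal_sum]
      exact div_mul_cancel₀ _ h0
    · simp [a, image_eq_zero_of_notMem_tsupport hx]
  refine ⟨∫ x, ‖∑ l, fderiv ℝ (a l) x (b l)‖, fun ε hε => ?_⟩
  have hdo : ∀ x, HasFDerivAt (fun y => osc ε (σ y))
      ((fderiv ℝ σ x).smulRight (osc ε (σ x) * (Complex.I / ε))) x := fun x => by
    have := (hasDerivAt_osc ε (σ x)).hasFDerivAt.comp x
      ((hσ.differentiable two_ne_zero) x).hasFDerivAt
    refine this.congr_fderiv ?_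
    ext v
    simp
  have hco : ContDiff ℝ 1 (fun y => osc ε (σ y)) :=
    (contDiff_osc ε).comp (hσ.of_le one_le_two)
  have hi1 : ∀ l, Integrable (fun x => fderiv ℝ (a l) x (b l) * osc ε (σ x)) := fun l =>
    ((((ha l).continuous_fderiv one_ne_zero).clm_apply continuous_const).mul
      hco.continuous).integrable_of_hasCompactSupport
      (((has l).fderiv_apply (𝕜 := ℝ) (b l)).mul_right)
  have hi2 : ∀ l, Integrable
      (fun x => a l x * (fderiv ℝ σ x (b l) : ℂ) * (osc ε (σ x) * (Complex.I / ε))) := fun l =>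
    (((ha l).continuous.mul (Complex.continuous_ofReal.comp (hD l).continuous)).mul
      (hco.continuous.mul continuous_const)).integrable_of_hasCompactSupport
      (((has l).mul_right).mul_right)
  have hl : ∀ l, (∫ x, fderiv ℝ (a l) x (b l) * osc ε (σ x)) +
      ∫ x, a l x * (fderiv ℝ σ x (b l) : ℂ) * (osc ε (σ x) * (Complex.I / ε)) = 0 := fun l => by
    rw [← integral_add (hi1 l) (hi2 l), ← integral_fderiv_eq_zero_of_hasCompactSupport
      ((ha l).mul hco) (has l).mul_right (b l)]
    congr 1
    funext x
    have hm : HasFDerivAt (fun y => a l y * osc ε (σ y)) _ x :=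
      (((ha l).differentiable one_ne_zero) x).hasFDerivAt.mul (hdo x)
    rw [hm.fderiv]
    simp only [add_apply, smul_apply,
      ContinuousLinearMap.smulRight_apply, smul_eq_mul, Complex.real_smul]
    ring
  have hl' : (∫ x, (∑ l, fderiv ℝ (a l) x (b l)) * osc ε (σ x)) +
      (∫ x, c x * osc ε (σ x)) * (Complex.I / ε) = 0 := by
    have h := Finset.sum_eq_zero fun l (_ : l ∈ Finset.univ) => hl l
    rw [Finset.sum_add_distrib, ← integral_finsetSum _ fun l _ => hi1 l,
      ← integral_finsetSum _ fun l _ => hi2 l] at h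
    simp_rw [← Finset.sum_mul, hsum] at h
    rw [← integral_mul_const]
    simpa [mul_assoc] using h
  have hn : ‖(∫ x, c x * osc ε (σ x))‖ * ε⁻¹ =
      ‖∫ x, (∑ l, fderiv ℝ (a l) x (b l)) * osc ε (σ x)‖ := by
    rw [eq_neg_of_add_eq_zero_left hl', norm_neg, norm_mul, norm_div, Complex.norm_I,
      Complex.norm_real, Real.norm_of_nonneg hε.le, one_div]
  have hle : ‖(∫ x, c x * osc ε (σ x))‖ * ε⁻¹ ≤ ∫ x, ‖∑ l, fderiv ℝ (a l) x (b l)‖ := by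
    rw [hn]
    refine (norm_integral_le_integral_norm _).trans_eq ?_
    simp
  rwa [← div_eq_mul_inv, div_le_iff₀' hε] at hle

/-- Riemann–Lebesgue lemma for a phase without stationary points on the support of the
amplitude. -/
theorem tendsto_integral_mul_osc {σ : E → ℝ} (hσ : ContDiff ℝ 2 σ) {c : E → ℂ}
    (hc : Integrable c) {K : Set E} (hK : IsClosed K) (hcK : ∀ x ∉ K, c x = 0)
    (hne : ∀ x ∈ K, fderiv ℝ σ x ≠ 0) :
    Tendsto (fun ε : ℝ => ∫ x, c x * osc ε (σ x)) (𝓝[>] 0) (𝓝 0) := by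
  have hV : IsOpen {x | fderiv ℝ σ x ≠ 0} :=
    isOpen_ne_fun (hσ.continuous_fderiv two_ne_zero) continuous_const
  -- the cutoff keeps the smooth `L¹` approximant of `c` away from the stationary points of `σ`
  obtain ⟨χ, hχ, hχ1, hχs, hχI⟩ := exists_contDiff_cutoff hK hV hne
  rw [Metric.tendsto_nhds]
  intro δ hδ
  obtain ⟨c', hc's, hc'd, hc'n⟩ := (memLp_one_iff_integrable.2 hc).exist_eLpNorm_sub_le
    ENNReal.one_ne_top (by norm_num) (half_pos hδ)
  have hc'i : Integrable c' (volume : Measure E) :=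
    hc'd.continuous.integrable_of_hasCompactSupport hc's
  have hdist : ∫ x, ‖c x - c' x‖ ≤ δ / 2 := by
    rw [← ENNReal.ofReal_le_ofReal_iff (half_pos hδ).le]
    have h := ofReal_integral_norm_eq_lintegral_enorm (hc.sub hc'i)
    rw [← eLpNorm_one_eq_lintegral_enorm] at h
    exact h.trans_le hc'n
  set u : E → ℂ := fun x => c' x * (χ x : ℂ)
  have hu : ContDiff ℝ 1 u := (hc'd.of_le (by exact_mod_cast le_top)).mul
    (Complex.ofRealCLM.contDiff.comp (hχ.of_le (by exact_mod_cast le_top)))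
  have hus : HasCompactSupport u := hc's.mul_right
  have hut : tsupport u ⊆ tsupport χ := closure_mono fun x hx => by
    simp only [u, Function.mem_support, ne_eq, mul_eq_zero, not_or] at hx ⊢
    exact_mod_cast hx.2
  obtain ⟨C, hC⟩ := exists_norm_integral_mul_osc_le hσ hu hus fun x hx => hχs (hut hx)
  have hui : Integrable u := hu.continuous.integrable_of_hasCompactSupport hus
  have hlim : Tendsto (fun ε : ℝ => ε * C) (𝓝[>] 0) (𝓝 0) := by
    have : Tendsto (fun ε : ℝ => ε * C) (𝓝 0) (𝓝 (0 * C)) := tendsto_id.mul_const C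
    rw [zero_mul] at this
    exact this.mono_left nhdsWithin_le_nhds
  filter_upwards [hlim.eventually_lt_const (half_pos hδ), self_mem_nhdsWithin] with ε hε hε0
  have hmeas : AEStronglyMeasurable (fun x => osc ε (σ x)) (volume : Measure E) :=
    ((continuous_osc ε).comp hσ.continuous).aestronglyMeasurable
  have hcu : ‖∫ x, (c x - u x) * osc ε (σ x)‖ ≤ δ / 2 := by
    refine (norm_integral_le_integral_norm _).trans ((integral_mono ?_ (hc.sub hc'i).norm
      fun x => ?_).trans hdist)
    · exact ((hc.sub hui).mul_bdd hmeas (Eventually.of_forall fun x => (norm_osc _ _).le)).norm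
    · have h1 : c x - u x = (c x - c' x) * χ x := by
        by_cases hx : x ∈ K
        · have : χ x = 1 := hχ1.self_of_nhdsSet x hx
          simp [u, this]
        · simp [u, hcK x hx]
      simp only [norm_mul, norm_osc, mul_one, h1, Complex.norm_real, Pi.sub_apply]
      exact mul_le_of_le_one_right (norm_nonneg _) (abs_le.2 ⟨by linarith [(hχI x).1], (hχI x).2⟩)
  rw [dist_zero_right]
  have hsplit : ∫ x, c x * osc ε (σ x) =
      (∫ x, (c x - u x) * osc ε (σ x)) + ∫ x, u x * osc ε (σ x) := by
    rw [← integral_add]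
    · simp_rw [← add_mul, sub_add_cancel]
    · exact (hc.sub hui).mul_bdd hmeas (Eventually.of_forall fun x => (norm_osc _ _).le)
    · exact hui.mul_bdd hmeas (Eventually.of_forall fun x => (norm_osc _ _).le)
  rw [hsplit]
  linarith [norm_add_le (∫ x, (c x - u x) * osc ε (σ x)) (∫ x, u x * osc ε (σ x)), hC ε hε0]

end NonStationary

/-! ### Partial Fourier transform of a Schwartz function on phase space -/

theorem norm_iteratedFDeriv_comp_prodMk_le {E G : Type*} [NormedAddCommGroup E] [NormedSpace ℝ E]
    [NormedAddCommGroup G] [NormedSpace ℝ G] {f : E × E → G} (hf : ContDiff ℝ ∞ f) (n : ℕ)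
    (x ξ : E) :
    ‖iteratedFDeriv ℝ n (fun η => f (x, η)) ξ‖ ≤ ‖iteratedFDeriv ℝ n f (x, ξ)‖ := by
  have h1 : (fun η => f (x, η)) =
      (fun q => f (q + (x, 0))) ∘ (ContinuousLinearMap.inr ℝ E E) := by
    funext η
    simp
  have h2 : ContDiff ℝ ∞ (fun q => f (q + (x, 0))) := hf.comp (by fun_prop)
  rw [h1, ContinuousLinearMap.iteratedFDeriv_comp_right _ h2 _ (i := n) (by exact_mod_cast le_top),
    iteratedFDeriv_comp_add_right]
  refine (ContinuousMultilinearMap.norm_compContinuousLinearMap_le _ _).trans ?_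
  have h3 : ((ContinuousLinearMap.inr ℝ E E) ξ + (x, 0) : E × E) = (x, ξ) := by simp
  rw [h3]
  refine mul_le_of_le_one_right (norm_nonneg _) ?_
  rw [Finset.prod_const]
  exact pow_le_one₀ (norm_nonneg _) (ContinuousLinearMap.norm_inr_le_one ℝ E E)

theorem decay_slice (a : 𝓢(Sp d × Sp d, ℂ)) (x : Sp d) (k n : ℕ) (ξ : Sp d) :
    ‖ξ‖ ^ k * ‖iteratedFDeriv ℝ n (fun η => a (x, η)) ξ‖ ≤ SchwartzMap.seminorm ℂ k n a := by
  refine le_trans ?_ (a.le_seminorm ℂ k n (x, ξ))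
  gcongr
  · exact le_max_right _ _
  · exact norm_iteratedFDeriv_comp_prodMk_le (a.smooth ⊤) n x ξ

/-- The Schwartz function `ξ ↦ a(x, ξ)`. -/
noncomputable def slice (a : 𝓢(Sp d × Sp d, ℂ)) (x : Sp d) : 𝓢(Sp d, ℂ) where
  toFun ξ := a (x, ξ)
  smooth' := (a.smooth ⊤).comp (contDiff_prodMk_right x)
  decay' k n := ⟨SchwartzMap.seminorm ℂ k n a, decay_slice a x k n⟩

@[simp] theorem slice_apply (a : 𝓢(Sp d × Sp d, ℂ)) (x ξ : Sp d) : slice a x ξ = a (x, ξ) := rfl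

theorem seminorm_slice_le (a : 𝓢(Sp d × Sp d, ℂ)) (x : Sp d) (k n : ℕ) :
    SchwartzMap.seminorm ℂ k n (slice a x) ≤ SchwartzMap.seminorm ℂ k n a :=
  SchwartzMap.seminorm_le_bound ℂ k n _ (apply_nonneg _ _) (decay_slice a x k n)

/-- The partial Fourier integral `b(x, z) = ∫ a(x, ξ) e^{i z·ξ} dξ`. -/
noncomputable def partialFourier (a : 𝓢(Sp d × Sp d, ℂ)) (x z : Sp d) : ℂ :=
  ∫ ξ : Sp d, a (x, ξ) * Complex.exp (Complex.I * ((⟪z, ξ⟫_ℝ : ℝ) : ℂ))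

open FourierTransform in
theorem partialFourier_eq (a : 𝓢(Sp d × Sp d, ℂ)) (x z : Sp d) :
    partialFourier a x z = (𝓕⁻ (slice a x)) ((2 * Real.pi)⁻¹ • z) := by
  rw [SchwartzMap.fourierInv_coe, Real.fourierInv_eq']
  unfold partialFourier
  congr 1
  funext ξ
  rw [slice_apply, smul_eq_mul, mul_comm, inner_smul_right, real_inner_comm z ξ]
  congr 2
  have : (Real.pi : ℂ) ≠ 0 := by exact_mod_cast Real.pi_ne_zero
  push_cast
  field_simp

/-- The partial Fourier transform is dominated, uniformly in `x`, by an integrable function of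
`z`: the slices `a(x, ·)` form a bounded subset of the Schwartz space. -/
theorem exists_integrable_bound_partialFourier (a : 𝓢(Sp d × Sp d, ℂ)) :
    ∃ B : Sp d → ℝ, Integrable B volume ∧ ∀ x z, ‖partialFourier a x z‖ ≤ B z := by
  set p := (Finset.Iic ((d + 1, 0) : ℕ × ℕ)).sup (schwartzSeminormFamily ℂ (Sp d) ℂ)
  set q : Seminorm ℂ 𝓢(Sp d, ℂ) :=
    p.comp (FourierTransform.fourierInvCLM ℂ 𝓢(Sp d, ℂ)).toLinearMap
  have hp : Continuous p :=
    Finset.sup_induction (p := fun r : Seminorm ℂ 𝓢(Sp d, ℂ) => Continuous r) continuous_zero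
      (fun _ h₁ _ h₂ => h₁.sup h₂)
      fun i _ => (schwartz_withSeminorms ℂ (Sp d) ℂ).continuous_seminorm i
  have hq : Continuous q := hp.comp (FourierTransform.fourierInvCLM ℂ 𝓢(Sp d, ℂ)).continuous
  obtain ⟨s, C, -, hC⟩ := Seminorm.bound_of_continuous (schwartz_withSeminorms ℂ (Sp d) ℂ) q hq
  set M : ℝ := C * (s.sup (schwartzSeminormFamily ℂ (Sp d × Sp d) ℂ)) a
  have hM : ∀ x, q (slice a x) ≤ M := fun x => by
    refine (hC _).trans ?_
    refine mul_le_mul_of_nonneg_left ?_ C.2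
    refine Seminorm.finset_sup_apply_le (apply_nonneg _ _) fun i hi => ?_
    exact (seminorm_slice_le a x i.1 i.2).trans
      (Seminorm.le_finset_sup_apply (p := schwartzSeminormFamily ℂ (Sp d × Sp d) ℂ) hi)
  refine ⟨fun z => 2 ^ (d + 1) * M * (1 + ‖(2 * Real.pi)⁻¹ • z‖) ^ (-((d + 1 : ℕ) : ℝ)), ?_, ?_⟩
  · refine Integrable.const_mul ?_ _
    exact (integrable_one_add_norm (E := Sp d) (μ := volume) (r := ((d + 1 : ℕ) : ℝ))
      (by simp)).comp_smul (inv_ne_zero Real.two_pi_pos.ne')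
  · intro x z
    set w := (2 * Real.pi)⁻¹ • z
    have h := SchwartzMap.one_add_le_sup_seminorm_apply (𝕜 := ℂ) (m := (d + 1, 0)) (k := d + 1)
      (n := 0) le_rfl le_rfl (FourierTransform.fourierInv (slice a x)) w
    rw [norm_iteratedFDeriv_zero] at h
    beta_reduce
    rw [partialFourier_eq, Real.rpow_neg (by positivity), Real.rpow_natCast,
      ← div_eq_mul_inv, le_div_iff₀ (by positivity), mul_comm]
    refine h.trans ?_
    gcongr
    exact hM x

/-- Fourier inversion in the momentum variable. -/
theorem integral_partialFourier_mul_exp (a : 𝓢(Sp d × Sp d, ℂ)) (x η : Sp d) :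
    ∫ z, partialFourier a x z * Complex.exp (-(Complex.I * ((⟪z, η⟫_ℝ : ℝ) : ℂ))) =
      (((2 * Real.pi) ^ d : ℝ) : ℂ) * a (x, η) := by
  have h1 : ∀ z : Sp d, partialFourier a x z * Complex.exp (-(Complex.I * ((⟪z, η⟫_ℝ : ℝ) : ℂ))) =
      (fun w : Sp d => Complex.exp (((-2 * Real.pi * ⟪w, η⟫_ℝ : ℝ) : ℂ) * Complex.I) •
        FourierTransform.fourierInv (slice a x) w) ((2 * Real.pi)⁻¹ • z) := fun z => by
    simp only [partialFourier_eq, smul_eq_mul, inner_smul_left]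
    rw [mul_comm]
    congr 2
    have : (Real.pi : ℂ) ≠ 0 := by exact_mod_cast Real.pi_ne_zero
    push_cast
    simp
    field_simp
  simp_rw [h1]
  rw [Measure.integral_comp_inv_smul_of_nonneg volume
    (fun w : Sp d => Complex.exp (((-2 * Real.pi * ⟪w, η⟫_ℝ : ℝ) : ℂ) * Complex.I) •
        FourierTransform.fourierInv (slice a x) w) Real.two_pi_pos.le, ← Real.fourier_eq',
    ← SchwartzMap.fourier_coe, FourierTransform.fourier_fourierInv_eq]
  simp

theorem continuous_partialFourier_integrand (a : 𝓢(Sp d × Sp d, ℂ)) :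
    Continuous fun q : (Sp d × Sp d) × Sp d =>
      a (q.1.1, q.2) * Complex.exp (Complex.I * ((⟪q.1.2, q.2⟫_ℝ : ℝ) : ℂ)) := by
  have := a.continuous
  fun_prop

theorem stronglyMeasurable_partialFourier (a : 𝓢(Sp d × Sp d, ℂ)) :
    StronglyMeasurable fun q : Sp d × Sp d => partialFourier a q.1 q.2 :=
  (continuous_partialFourier_integrand a).stronglyMeasurable.integral_prod_right'

theorem exists_integrable_bound_slice (a : 𝓢(Sp d × Sp d, ℂ)) :
    ∃ B : Sp d → ℝ, Integrable B volume ∧ ∀ x ξ, ‖a (x, ξ)‖ ≤ B ξ := by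
  set M := (Finset.Iic ((d + 1, 0) : ℕ × ℕ)).sup
    (fun m => SchwartzMap.seminorm ℂ m.1 m.2 (E := Sp d × Sp d) (F := ℂ)) a
  refine ⟨fun ξ => 2 ^ (d + 1) * M * (1 + ‖ξ‖) ^ (-((d + 1 : ℕ) : ℝ)),
    (integrable_one_add_norm (E := Sp d) (μ := volume) (r := ((d + 1 : ℕ) : ℝ))
      (by simp)).const_mul _, fun x ξ => ?_⟩
  have h := SchwartzMap.one_add_le_sup_seminorm_apply (𝕜 := ℂ) (m := (d + 1, 0)) (k := d + 1)
      (n := 0) le_rfl le_rfl a (x, ξ)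
  rw [norm_iteratedFDeriv_zero] at h
  beta_reduce
  rw [Real.rpow_neg (by positivity), Real.rpow_natCast,
      ← div_eq_mul_inv, le_div_iff₀ (by positivity), mul_comm]
  refine le_trans ?_ h
  gcongr
  exact le_max_right _ _

/-! ### Pairing a Wigner transform with a test function -/

theorem integrable_comp_sub_mul_comp_add {f h : Sp d → ℂ} (hf : Integrable f) (hh : Integrable h)
    {ε : ℝ} (hε : ε ≠ 0) :
    Integrable (fun q : Sp d × Sp d =>
      f (q.1 - (ε / 2) • q.2) * (starRingEnd ℂ) (h (q.1 + (ε / 2) • q.2)))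
      ((volume : Measure (Sp d)).prod volume) := by
  let L : (Sp d × Sp d) →ₗ[ℝ] (Sp d × Sp d) :=
    LinearMap.prod (LinearMap.fst ℝ (Sp d) (Sp d) - (ε / 2) • LinearMap.snd ℝ (Sp d) (Sp d))
      (LinearMap.fst ℝ (Sp d) (Sp d) + (ε / 2) • LinearMap.snd ℝ (Sp d) (Sp d))
  have hLa : ∀ q, L q = (q.1 - (ε / 2) • q.2, q.1 + (ε / 2) • q.2) := fun q => rfl
  have hL : Function.Injective L := by
    rw [injective_iff_map_eq_zero]
    intro q hq
    rw [hLa, Prod.mk_eq_zero] at hq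
    have h1 : (2 : ℝ) • q.1 = 0 := by
      rw [two_smul]; simpa using congrArg₂ (· + ·) hq.1 hq.2
    have h2 : q.1 = 0 := (smul_eq_zero.1 h1).resolve_left two_ne_zero
    have h3 : q.2 = 0 := by
      have := hq.2
      rw [h2, zero_add] at this
      exact (smul_eq_zero.1 this).resolve_left (by simpa using hε)
    exact Prod.ext h2 h3
  let e := (LinearEquiv.ofInjectiveEndo L hL)
  have hdet : LinearMap.det L ≠ 0 := e.isUnit_det'.ne_zero
  have hm := Measure.map_linearMap_addHaar_eq_smul_addHaar
    ((volume : Measure (Sp d)).prod volume) hdet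
  have hemb : MeasurableEmbedding L :=
    e.toContinuousLinearEquiv.toHomeomorph.measurableEmbedding
  have hint : Integrable (fun q : Sp d × Sp d => f q.1 * (starRingEnd ℂ) (h q.2))
      (Measure.map L ((volume : Measure (Sp d)).prod volume)) := by
    have hh' : Integrable (fun x => (starRingEnd ℂ) (h x)) :=
      hh.mono (Complex.continuous_conj.comp_aestronglyMeasurable hh.1)
        (Eventually.of_forall fun x => by simp)
    have hp : Integrable (fun q : Sp d × Sp d => f q.1 * (starRingEnd ℂ) (h q.2))
      ((volume : Measure (Sp d)).prod volume) := hf.mul_prod hh'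
    rw [hm]
    exact hp.smul_measure ENNReal.ofReal_ne_top
  exact hemb.integrable_map_iff.1 hint

theorem measurePreserving_swap_snd {E : Type*} [MeasureSpace E]
    [SFinite (volume : Measure E)] :
    MeasurePreserving (fun q : (E × E) × E => ((q.1.1, q.2), q.1.2)) := by
  have h1 := volume_preserving_prodAssoc (α₁ := E) (β₁ := E) (γ₁ := E)
  have h2 : MeasurePreserving (Prod.map id Prod.swap : E × (E × E) → E × (E × E)) :=
    (MeasurePreserving.id volume).prod Measure.measurePreserving_swap
  have h3 := (volume_preserving_prodAssoc (α₁ := E) (β₁ := E) (γ₁ := E)).symm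
  exact h3.comp (h2.comp h1)

theorem integrable_partialFourier_mul (a : 𝓢(Sp d × Sp d, ℂ)) {K : Sp d × Sp d → ℂ}
    (hK : Integrable K) :
    Integrable (fun r : (Sp d × Sp d) × Sp d => K r.1 * (a (r.1.1, r.2) *
      Complex.exp (Complex.I * ((⟪r.1.2, r.2⟫_ℝ : ℝ) : ℂ)))) := by
  obtain ⟨B, hB, haB⟩ := exists_integrable_bound_slice a
  refine (hK.norm.mul_prod hB).mono ?_ (Eventually.of_forall fun r => ?_)
  · exact hK.aestronglyMeasurable.comp_fst.mul
      (continuous_partialFourier_integrand a).aestronglyMeasurable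
  · rw [norm_mul, norm_mul, mul_comm Complex.I, Complex.norm_exp_ofReal_mul_I, mul_one, norm_mul,
      norm_norm]
    gcongr
    exact (haB _ _).trans (le_abs_self _)

/-- Fubini for the pairing of a Wigner transform with a test function: the momentum integral
turns the test function into its partial Fourier transform. -/
theorem integral_mul_wigner (a : 𝓢(Sp d × Sp d, ℂ)) {f h : Sp d → ℂ} (hf : Integrable f)
    (hh : Integrable h) {ε : ℝ} (hε : ε ≠ 0) :
    ∫ p : Sp d × Sp d, a p * wigner ε f h p.1 p.2 =
      (((2 * Real.pi) ^ d)⁻¹ : ℝ) * ∫ z : Sp d, ∫ x : Sp d, partialFourier a x z *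
        (f (x - (ε / 2) • z) * (starRingEnd ℂ) (h (x + (ε / 2) • z))) := by
  set K : Sp d × Sp d → ℂ := fun q =>
    f (q.1 - (ε / 2) • q.2) * (starRingEnd ℂ) (h (q.1 + (ε / 2) • q.2))
  have hK : Integrable K := integrable_comp_sub_mul_comp_add hf hh hε
  set T : (Sp d × Sp d) × Sp d → ℂ := fun r => K r.1 * (a (r.1.1, r.2) *
      Complex.exp (Complex.I * ((⟪r.1.2, r.2⟫_ℝ : ℝ) : ℂ)))
  have hT : Integrable T := integrable_partialFourier_mul a hK
  have hsw := measurePreserving_swap_snd (E := Sp d)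
  have hT' : Integrable (fun r : (Sp d × Sp d) × Sp d => T ((r.1.1, r.2), r.1.2)) :=
    hsw.integrable_comp_of_integrable hT
  have hemb : MeasurableEmbedding (fun q : (Sp d × Sp d) × Sp d => ((q.1.1, q.2), q.1.2)) :=
    ((MeasurableEquiv.prodAssoc.trans ((MeasurableEquiv.refl (Sp d)).prodCongr
      MeasurableEquiv.prodComm)).trans MeasurableEquiv.prodAssoc.symm).measurableEmbedding
  have e1 : ∫ p : Sp d × Sp d, a p * wigner ε f h p.1 p.2 =
      (((2 * Real.pi) ^ d)⁻¹ : ℝ) *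
        ∫ r : (Sp d × Sp d) × Sp d, T ((r.1.1, r.2), r.1.2) := by
    have h0 : ∫ r : (Sp d × Sp d) × Sp d, T ((r.1.1, r.2), r.1.2) =
        ∫ p : Sp d × Sp d, ∫ z : Sp d, T ((p.1, z), p.2) := integral_prod _ hT'
    rw [h0, ← integral_const_mul]
    congr 1
    funext p
    simp only [wigner, T, K]
    rw [mul_left_comm, ← integral_const_mul]
    congr 2
    funext z
    ring
  have e2 : ∫ r, T r = ∫ z : Sp d, ∫ x : Sp d, partialFourier a x z * K (x, z) := by
    have hi : Integrable (fun q : Sp d × Sp d => partialFourier a q.1 q.2 * K q)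
        (volume.prod volume) := by
      refine hT.integral_prod_left.congr (Eventually.of_forall fun q => ?_)
      simp only [T, integral_const_mul]
      rw [mul_comm]
      rfl
    have h0 : ∫ r, T r = ∫ q : Sp d × Sp d, ∫ ξ : Sp d, T (q, ξ) := integral_prod _ hT
    rw [h0, ← integral_prod_symm (fun q : Sp d × Sp d => partialFourier a q.1 q.2 * K q) hi]
    simp only [T, integral_const_mul]
    congr 1
    funext q
    rw [mul_comm]
    rfl
  rw [e1, hsw.integral_comp hemb, e2]

/-! ### Semiclassical correlations at a fixed separation -/

section Correlation

variable {E : Type*} [NormedAddCommGroup E] [InnerProductSpace ℝ E]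

theorem osc_add (ε s s' : ℝ) : osc ε (s + s') = osc ε s * osc ε s' := by
  rw [osc, osc, osc, ← Complex.exp_add]
  congr 1
  push_cast
  ring

theorem conj_osc (ε s : ℝ) : (starRingEnd ℂ) (osc ε s) = osc ε (-s) := by
  rw [osc, osc, ← Complex.exp_conj]
  congr 1
  simp [div_eq_mul_inv]

theorem osc_zero (ε : ℝ) : osc ε 0 = 1 := by simp [osc]

theorem osc_eq (ε s : ℝ) : osc ε s = Complex.exp (Complex.I * ((ε⁻¹ * s : ℝ) : ℂ)) := by
  rw [osc]
  congr 1
  push_cast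
  ring

/-- The phase difference at separation `εz` converges, after division by `ε`, to
`-(dS(x) + dS'(x)) z / 2`. -/
theorem tendsto_osc_increment {S S' : E → ℝ} {x : E} (hS : DifferentiableAt ℝ S x)
    (hS' : DifferentiableAt ℝ S' x) (z : E) :
    Tendsto (fun ε : ℝ => osc ε ((S (x - (ε / 2) • z) - S x) - (S' (x + (ε / 2) • z) - S' x)))
      (𝓝[>] 0)
      (𝓝 (Complex.exp (-(Complex.I * (((fderiv ℝ S x z + fderiv ℝ S' x z) / 2 : ℝ) : ℂ))))) := by
  have key : ∀ {u : E → ℝ}, DifferentiableAt ℝ u x → ∀ w : E,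
      Tendsto (fun ε : ℝ => ε⁻¹ * (u (x + ε • w) - u x)) (𝓝[>] 0) (𝓝 (fderiv ℝ u x w)) := by
    intro u hu w
    have h1 := (hu.hasFDerivAt.hasLineDerivAt w).tendsto_slope_zero_right
    simpa using h1
  have h1 := (key hS (-(1 / 2 : ℝ) • z)).sub (key hS' ((1 / 2 : ℝ) • z))
  have hc : Continuous fun r : ℝ => Complex.exp (Complex.I * (r : ℂ)) := by fun_prop
  have h2 := (hc.tendsto _).comp h1
  have e : Complex.exp (Complex.I * ((fderiv ℝ S x (-(1 / 2 : ℝ) • z) -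
      fderiv ℝ S' x ((1 / 2 : ℝ) • z) : ℝ) : ℂ)) =
      Complex.exp (-(Complex.I * (((fderiv ℝ S x z + fderiv ℝ S' x z) / 2 : ℝ) : ℂ))) := by
    congr 1
    rw [map_smul, map_smul, smul_eq_mul, smul_eq_mul]
    push_cast
    ring
  rw [e] at h2
  refine h2.congr fun ε => ?_
  have hm : x + ε • -(1 / 2 : ℝ) • z = x - (ε / 2) • z := by
    rw [neg_smul, smul_neg, smul_smul, ← sub_eq_add_neg, mul_one_div]
  have hp : x + ε • (1 / 2 : ℝ) • z = x + (ε / 2) • z := by rw [smul_smul, mul_one_div]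
  rw [osc_eq, Function.comp_apply, hm, hp, ← mul_sub]

variable [FiniteDimensional ℝ E] [MeasurableSpace E] [BorelSpace E]

theorem tendsto_eLpNorm_translate_sub {f : E → ℝ} (hf : MemLp f 2 (volume : Measure E)) :
    Tendsto (fun y : E => eLpNorm (fun x => f (x + y) - f x) 2 volume) (𝓝 0) (𝓝 0) := by
  have : Fact ((1 : ℝ≥0∞) ≤ 2) := ⟨one_le_two⟩
  let τ : E → C(E, E) := fun y => ⟨fun x => x + y, by fun_prop⟩
  have hτ : Continuous τ := ContinuousMap.continuous_of_continuous_uncurry _ (by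
    change Continuous fun q : E × E => q.2 + q.1
    fun_prop)
  have hm : ∀ y, MeasurePreserving (τ y) (volume : Measure E) volume := fun y =>
    measurePreserving_add_right volume y
  have h := Tendsto.compMeasurePreservingLp (f := fun _ : E => hf.toLp f) (f₀ := hf.toLp f)
    (g := τ) (g₀ := τ 0) (l := 𝓝 0) tendsto_const_nhds (hτ.tendsto 0) hm (hm 0)
    ENNReal.ofNat_ne_top
  rw [tendsto_iff_edist_tendsto_0] at h
  refine h.congr fun y => ?_
  rw [Lp.toLp_compMeasurePreserving, Lp.toLp_compMeasurePreserving, Lp.edist_toLp_toLp]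
  congr 1
  funext x
  simp [τ]

/-- Products of translates of `L²` functions converge in `L¹`. -/
theorem tendsto_eLpNorm_translate_mul_translate_sub {f h : E → ℝ}
    (hf : MemLp f 2 (volume : Measure E)) (hh : MemLp h 2 (volume : Measure E))
    {ι : Type*} {l : Filter ι} {y y' : ι → E} (hy : Tendsto y l (𝓝 0)) (hy' : Tendsto y' l (𝓝 0)) :
    Tendsto (fun i => eLpNorm (fun x => f (x + y i) * h (x + y' i) - f x * h x) 1 volume) l
      (𝓝 0) := by
  have hsh : ∀ {u : E → ℝ}, MemLp u 2 (volume : Measure E) → ∀ w : E,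
      MemLp (fun x => u (x + w)) 2 (volume : Measure E) := fun hu w =>
    hu.comp_measurePreserving (measurePreserving_add_right volume w)
  have hn : ∀ w : E, eLpNorm (fun x => h (x + w)) 2 (volume : Measure E) = eLpNorm h 2 volume :=
    fun w => eLpNorm_comp_measurePreserving hh.1 (measurePreserving_add_right volume w)
  have key : ∀ i, eLpNorm (fun x => f (x + y i) * h (x + y' i) - f x * h x) 1 (volume : Measure E) ≤
      eLpNorm (fun x => f (x + y i) - f x) 2 volume * eLpNorm h 2 volume +
        eLpNorm f 2 volume * eLpNorm (fun x => h (x + y' i) - h x) 2 volume := fun i => by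
    have e : (fun x => f (x + y i) * h (x + y' i) - f x * h x) =
        (fun x => f (x + y i) - f x) • (fun x => h (x + y' i)) +
          f • (fun x => h (x + y' i) - h x) := by
      funext x
      simp only [Pi.add_apply, Pi.mul_apply, smul_eq_mul]
      ring
    have m1 := ((hsh hf (y i)).sub hf).1
    have m2 := ((hsh hh (y' i)).sub hh).1
    rw [e]
    refine (eLpNorm_add_le (m1.smul (hsh hh (y' i)).1) (hf.1.smul m2) le_rfl).trans ?_
    refine add_le_add ?_ ?_
    · rw [← hn (y' i)]
      exact eLpNorm_smul_le_mul_eLpNorm (p := 2) (q := 2) (r := 1) (hsh hh (y' i)).1 m1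
    · exact eLpNorm_smul_le_mul_eLpNorm (p := 2) (q := 2) (r := 1) m2 hf.1
  have h1 := ENNReal.Tendsto.mul_const (b := eLpNorm h 2 (volume : Measure E))
    ((tendsto_eLpNorm_translate_sub hf).comp hy) (Or.inr hh.2.ne)
  have h2 := ENNReal.Tendsto.const_mul (a := eLpNorm f 2 (volume : Measure E))
    ((tendsto_eLpNorm_translate_sub hh).comp hy') (Or.inr hf.2.ne)
  have h3 := h1.add h2
  simp only [zero_mul, mul_zero, add_zero] at h3
  exact tendsto_of_tendsto_of_tendsto_of_le_of_le tendsto_const_nhds h3 (fun _ => bot_le) key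

/-- The limiting amplitude `β A A' e^{-i (dS + dS') z / 2}` of the correlation of two wave packets
at separation `εz`. -/
noncomputable def correlationLimit (β : E → ℂ) (A A' S S' : E → ℝ) (z x : E) : ℂ :=
  β x * ((A x * A' x : ℝ) : ℂ) *
    Complex.exp (-(Complex.I * (((fderiv ℝ S x z + fderiv ℝ S' x z) / 2 : ℝ) : ℂ)))

variable {β : E → ℂ} {M : ℝ} {A A' S S' : E → ℝ}

theorem memLp_translate (hA : MemLp A 2 (volume : Measure E)) (w : E) :
    MemLp (fun x => A (x + w)) 2 (volume : Measure E) :=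
  hA.comp_measurePreserving (measurePreserving_add_right volume w)

theorem norm_exp_neg_I_mul (r : ℝ) : ‖Complex.exp (-(Complex.I * (r : ℂ)))‖ = 1 := by
  rw [Complex.norm_exp]
  simp

theorem integrable_correlationLimit (hβ : AEStronglyMeasurable β (volume : Measure E))
    (hβM : ∀ x, ‖β x‖ ≤ M) (hA : MemLp A 2 (volume : Measure E))
    (hA' : MemLp A' 2 (volume : Measure E)) (hS : ContDiff ℝ 1 S) (hS' : ContDiff ℝ 1 S') (z : E) :
    Integrable (correlationLimit β A A' S S' z) := by
  have h1 : Integrable (fun x => ((A x * A' x : ℝ) : ℂ)) (volume : Measure E) :=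
    (hA.integrable_mul hA').ofReal
  refine (h1.bdd_mul hβ (Eventually.of_forall hβM)).mul_bdd (c := 1) ?_
    (Eventually.of_forall fun x => (norm_exp_neg_I_mul _).le)
  have h2 := hS.continuous_fderiv one_ne_zero
  have h3 := hS'.continuous_fderiv one_ne_zero
  exact Continuous.aestronglyMeasurable (by fun_prop)

/-- The correlation of two wave packets at separation `εz`, with the fast oscillation
`e^{i(S - S')/ε}` removed, converges in `L¹`. -/
theorem tendsto_integral_norm_correlation_sub (hβM : ∀ x, ‖β x‖ ≤ M)
    (hA : MemLp A 2 (volume : Measure E)) (hA' : MemLp A' 2 (volume : Measure E))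
    (hS : ContDiff ℝ 1 S) (hS' : ContDiff ℝ 1 S') (z : E) :
    Tendsto (fun ε : ℝ => ∫ x, ‖β x * ((A (x - (ε / 2) • z) * A' (x + (ε / 2) • z) : ℝ) : ℂ) *
        osc ε ((S (x - (ε / 2) • z) - S x) - (S' (x + (ε / 2) • z) - S' x)) -
        correlationLimit β A A' S S' z x‖) (𝓝[>] 0) (𝓝 0) := by
  have hM : 0 ≤ M := (norm_nonneg _).trans (hβM 0)
  have hy' : Tendsto (fun ε : ℝ => (ε / 2) • z) (𝓝[>] 0) (𝓝 0) := by
    have hc : Continuous fun ε : ℝ => (ε / 2) • z := by fun_prop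
    have := hc.tendsto 0
    simp only [zero_div, zero_smul] at this
    exact this.mono_left nhdsWithin_le_nhds
  have hy : Tendsto (fun ε : ℝ => -((ε / 2) • z)) (𝓝[>] 0) (𝓝 0) := by simpa using hy'.neg
  set ph : ℝ → E → ℂ := fun ε x =>
    osc ε ((S (x - (ε / 2) • z) - S x) - (S' (x + (ε / 2) • z) - S' x))
  set ph0 : E → ℂ := fun x =>
    Complex.exp (-(Complex.I * (((fderiv ℝ S x z + fderiv ℝ S' x z) / 2 : ℝ) : ℂ)))
  have hphm : ∀ ε, Continuous (ph ε) := fun ε => by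
    have h1 := hS.continuous
    have h2 := hS'.continuous
    exact (continuous_osc ε).comp (by fun_prop)
  have hph0m : Continuous ph0 := by
    have h2 := hS.continuous_fderiv one_ne_zero
    have h3 := hS'.continuous_fderiv one_ne_zero
    fun_prop
  have hint : Integrable (fun x => A x * A' x) (volume : Measure E) := hA.integrable_mul hA'
  have hintε : ∀ ε : ℝ, Integrable (fun x => A (x - (ε / 2) • z) * A' (x + (ε / 2) • z))
      (volume : Measure E) := fun ε => by
    simp_rw [sub_eq_add_neg]
    exact (memLp_translate hA _).integrable_mul (memLp_translate hA' _)
  have t1 : Tendsto (fun ε : ℝ =>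
      ∫ x, ‖A (x - (ε / 2) • z) * A' (x + (ε / 2) • z) - A x * A' x‖) (𝓝[>] 0) (𝓝 0) := by
    have h := (ENNReal.tendsto_toReal ENNReal.zero_ne_top).comp
      (tendsto_eLpNorm_translate_mul_translate_sub hA hA' hy hy')
    rw [ENNReal.toReal_zero] at h
    refine h.congr fun ε => ?_
    simp only [Function.comp_apply, ← sub_eq_add_neg]
    rw [eLpNorm_one_eq_lintegral_enorm]
    exact (integral_norm_eq_lintegral_enorm ((hintε ε).sub hint).1).symm
  have t2 : Tendsto (fun ε : ℝ => ∫ x, ‖A x * A' x‖ * ‖ph ε x - ph0 x‖) (𝓝[>] 0) (𝓝 0) := by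
    suffices h0 : Tendsto (fun ε : ℝ => ∫ x, ‖A x * A' x‖ * ‖ph ε x - ph0 x‖) (𝓝[>] 0)
        (𝓝 (∫ x : E, ‖A x * A' x‖ * 0)) by simpa using h0
    refine tendsto_integral_filter_of_dominated_convergence (fun x => ‖A x * A' x‖ * 2) ?_ ?_
      (hint.norm.mul_const 2) ?_
    · exact Eventually.of_forall fun ε => hint.norm.1.mul
        ((hphm ε).sub hph0m).norm.aestronglyMeasurable
    · refine Eventually.of_forall fun ε => Eventually.of_forall fun x => ?_
      rw [norm_mul, norm_norm, norm_norm]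
      gcongr
      refine (norm_sub_le _ _).trans ?_
      rw [norm_osc, norm_exp_neg_I_mul]
      norm_num
    · refine Eventually.of_forall fun x => ?_
      have h := tendsto_osc_increment (hS.differentiable one_ne_zero x)
        (hS'.differentiable one_ne_zero x) z
      have h' := (h.sub_const (ph0 x)).norm
      rw [sub_self, norm_zero] at h'
      exact h'.const_mul _
  have t3 := (t1.const_mul M).add (t2.const_mul M)
  simp only [mul_zero, add_zero] at t3
  refine tendsto_of_tendsto_of_tendsto_of_le_of_le tendsto_const_nhds t3
    (fun ε => integral_nonneg fun x => norm_nonneg _) fun ε => ?_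
  have hi1 : Integrable (fun x => ‖A (x - (ε / 2) • z) * A' (x + (ε / 2) • z) - A x * A' x‖)
      (volume : Measure E) := ((hintε ε).sub hint).norm
  have hi2 : Integrable (fun x => ‖A x * A' x‖ * ‖ph ε x - ph0 x‖) (volume : Measure E) := by
    refine hint.norm.mul_bdd (c := 2) ((hphm ε).sub hph0m).norm.aestronglyMeasurable
      (Eventually.of_forall fun x => ?_)
    rw [norm_norm]
    refine (norm_sub_le _ _).trans ?_
    rw [norm_osc, norm_exp_neg_I_mul]
    norm_num
  beta_reduce
  rw [← integral_const_mul, ← integral_const_mul,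
    ← integral_add (hi1.const_mul M) (hi2.const_mul M)]
  refine integral_mono_of_nonneg (Eventually.of_forall fun x => norm_nonneg _)
    ((hi1.const_mul M).add (hi2.const_mul M)) (Eventually.of_forall fun x => ?_)
  have e : β x * ((A (x - (ε / 2) • z) * A' (x + (ε / 2) • z) : ℝ) : ℂ) * ph ε x -
      correlationLimit β A A' S S' z x =
      β x * (((A (x - (ε / 2) • z) * A' (x + (ε / 2) • z) - A x * A' x : ℝ) : ℂ) * ph ε x) +
        β x * (((A x * A' x : ℝ) : ℂ) * (ph ε x - ph0 x)) := by
    simp only [correlationLimit, ph0]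
    push_cast
    ring
  change ‖β x * ((A (x - (ε / 2) • z) * A' (x + (ε / 2) • z) : ℝ) : ℂ) * ph ε x -
      correlationLimit β A A' S S' z x‖ ≤ _
  rw [e]
  refine (norm_add_le _ _).trans ?_
  rw [norm_mul, norm_mul, norm_mul, norm_mul, norm_osc, Complex.norm_real, Complex.norm_real,
    mul_one]
  exact add_le_add (mul_le_mul_of_nonneg_right (hβM x) (norm_nonneg _))
    (mul_le_mul_of_nonneg_right (hβM x) (by positivity))

/-- The correlation `∫ β f^ε(x - εz/2) conj(h^ε(x + εz/2)) dx` of the wave packets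
`f^ε = A e^{iS/ε}` and `h^ε = A' e^{iS'/ε}` differs by `o(1)` from an oscillatory integral with
fixed amplitude and phase `S - S'`. -/
theorem tendsto_correlation_sub
    (hβ : AEStronglyMeasurable β (volume : Measure E)) (hβM : ∀ x, ‖β x‖ ≤ M)
    (hA : MemLp A 2 (volume : Measure E)) (hA' : MemLp A' 2 (volume : Measure E))
    (hS : ContDiff ℝ 1 S) (hS' : ContDiff ℝ 1 S') (z : E) :
    Tendsto (fun ε : ℝ => (∫ x, β x * ((A (x - (ε / 2) • z) * osc ε (S (x - (ε / 2) • z))) *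
        (starRingEnd ℂ) (A' (x + (ε / 2) • z) * osc ε (S' (x + (ε / 2) • z))))) -
        ∫ x, correlationLimit β A A' S S' z x * osc ε (S x - S' x)) (𝓝[>] 0) (𝓝 0) := by
  rw [tendsto_zero_iff_norm_tendsto_zero]
  refine tendsto_of_tendsto_of_tendsto_of_le_of_le tendsto_const_nhds
    (tendsto_integral_norm_correlation_sub hβM hA hA' hS hS' z) (fun ε => norm_nonneg _)
    fun ε => ?_
  set c : E → ℂ := fun x => β x * ((A (x - (ε / 2) • z) * A' (x + (ε / 2) • z) : ℝ) : ℂ) *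
        osc ε ((S (x - (ε / 2) • z) - S x) - (S' (x + (ε / 2) • z) - S' x))
  have hS1 := hS.continuous
  have hS2 := hS'.continuous
  have hc : Integrable c := by
    have h1 : Integrable (fun x => A (x - (ε / 2) • z) * A' (x + (ε / 2) • z))
        (volume : Measure E) := by
      simp_rw [sub_eq_add_neg]
      exact (memLp_translate hA _).integrable_mul (memLp_translate hA' _)
    exact (h1.ofReal.bdd_mul hβ (Eventually.of_forall hβM)).mul_bdd (c := 1)
      ((continuous_osc ε).comp (by fun_prop)).aestronglyMeasurable
      (Eventually.of_forall fun x => (norm_osc _ _).le)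
  have hc0 := integrable_correlationLimit hβ hβM hA hA' hS hS' z
  have ho : AEStronglyMeasurable (fun x => osc ε (S x - S' x)) (volume : Measure E) :=
    ((continuous_osc ε).comp (hS1.sub hS2)).aestronglyMeasurable
  have hob : ∀ᵐ x ∂(volume : Measure E), ‖osc ε (S x - S' x)‖ ≤ 1 :=
    Eventually.of_forall fun x => (norm_osc _ _).le
  have e : ∀ x, β x * ((A (x - (ε / 2) • z) * osc ε (S (x - (ε / 2) • z))) *
      (starRingEnd ℂ) (A' (x + (ε / 2) • z) * osc ε (S' (x + (ε / 2) • z)))) =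
      c x * osc ε (S x - S' x) := fun x => by
    have h : osc ε ((S (x - (ε / 2) • z) - S x) - (S' (x + (ε / 2) • z) - S' x)) *
        osc ε (S x - S' x) = osc ε (S (x - (ε / 2) • z)) * osc ε (-S' (x + (ε / 2) • z)) := by
      rw [← osc_add, ← osc_add]
      congr 1
      ring
    simp only [c]
    rw [mul_assoc (β x * _), h, map_mul, conj_osc, Complex.conj_ofReal]
    push_cast
    ring
  simp_rw [e]
  rw [← integral_sub (hc.mul_bdd ho hob) (hc0.mul_bdd ho hob)]
  refine (norm_integral_le_integral_norm _).trans_eq ?_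
  congr 1
  funext x
  rw [← sub_mul, norm_mul, norm_osc, mul_one]

/-- A wave packet correlated with itself: the fast oscillation cancels. -/
theorem tendsto_correlation_self
    (hβ : AEStronglyMeasurable β (volume : Measure E)) (hβM : ∀ x, ‖β x‖ ≤ M)
    (hA : MemLp A 2 (volume : Measure E)) (hS : ContDiff ℝ 1 S) (z : E) :
    Tendsto (fun ε : ℝ => ∫ x, β x * ((A (x - (ε / 2) • z) * osc ε (S (x - (ε / 2) • z))) *
        (starRingEnd ℂ) (A (x + (ε / 2) • z) * osc ε (S (x + (ε / 2) • z))))) (𝓝[>] 0)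
      (𝓝 (∫ x, correlationLimit β A A S S z x)) := by
  have h := (tendsto_correlation_sub hβ hβM hA hA hS hS z).add_const
    (∫ x, correlationLimit β A A S S z x)
  simpa [osc_zero] using h

/-- Wave packets with nowhere equal frequencies decorrelate. -/
theorem tendsto_correlation_of_fderiv_ne
    (hβ : AEStronglyMeasurable β (volume : Measure E)) (hβM : ∀ x, ‖β x‖ ≤ M)
    (hA : MemLp A 2 (volume : Measure E)) (hA' : MemLp A' 2 (volume : Measure E))
    (hS : ContDiff ℝ 2 S) (hS' : ContDiff ℝ 2 S') {K : Set E} (hK : IsClosed K)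
    (hAK : ∀ x ∉ K, A x = 0) (hne : ∀ x ∈ K, fderiv ℝ S x ≠ fderiv ℝ S' x) (z : E) :
    Tendsto (fun ε : ℝ => ∫ x, β x * ((A (x - (ε / 2) • z) * osc ε (S (x - (ε / 2) • z))) *
        (starRingEnd ℂ) (A' (x + (ε / 2) • z) * osc ε (S' (x + (ε / 2) • z))))) (𝓝[>] 0)
      (𝓝 0) := by
  have hS1 := hS.of_le one_le_two
  have hS2 := hS'.of_le one_le_two
  have h1 := tendsto_integral_mul_osc (hS.sub hS')
    (integrable_correlationLimit hβ hβM hA hA' hS1 hS2 z) hK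
    (fun x hx => by simp [correlationLimit, hAK x hx]) fun x hx => by
      have : fderiv ℝ (fun y => S y - S' y) x = fderiv ℝ S x - fderiv ℝ S' x :=
        fderiv_fun_sub (hS1.differentiable one_ne_zero x) (hS2.differentiable one_ne_zero x)
      change fderiv ℝ (fun y => S y - S' y) x ≠ 0
      rw [this]
      exact sub_ne_zero.2 (hne x hx)
  have h2 := (tendsto_correlation_sub hβ hβM hA hA' hS1 hS2 z).add h1
  simpa using h2

end Correlation

/-! ### The semiclassical limit of a multiphase WKB function -/

section Limit

variable {N : ℕ}

/-- The superposition `∑_j A_j e^{iS_j/ε}` of `N` wave packets. -/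
noncomputable def wkbSum (A S : Fin N → Sp d → ℝ) (ε : ℝ) (x : Sp d) : ℂ :=
  ∑ j, (A j x : ℂ) * osc ε (S j x)

variable {A S : Fin N → Sp d → ℝ}

theorem memLp_mul_osc {u s : Sp d → ℝ} (hu : MemLp u 2 volume) (hs : Continuous s) (ε : ℝ) :
    MemLp (fun x => (u x : ℂ) * osc ε (s x)) 2 volume :=
  hu.mono ((Complex.continuous_ofReal.comp_aestronglyMeasurable hu.1).mul
    ((continuous_osc ε).comp hs).aestronglyMeasurable)
    (Eventually.of_forall fun x => by rw [norm_mul, norm_osc, mul_one, Complex.norm_real])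

theorem memLp_wkbSum (hA : ∀ j, MemLp (A j) 2 volume) (hS : ∀ j, Continuous (S j)) (ε : ℝ) :
    MemLp (wkbSum A S ε) 2 volume :=
  memLp_finsetSum _ fun j _ => memLp_mul_osc (hA j) (hS j) ε

theorem eLpNorm_wkbSum_le (hA : ∀ j, MemLp (A j) 2 volume) (hS : ∀ j, Continuous (S j)) (ε : ℝ) :
    eLpNorm (wkbSum A S ε) 2 volume ≤ ENNReal.ofReal (∑ j, eLpNorm (A j) 2 volume).toReal := by
  rw [ENNReal.ofReal_toReal (ENNReal.sum_ne_top.2 fun j _ => (hA j).2.ne)]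
  have h : wkbSum A S ε = ∑ j, fun x => (A j x : ℂ) * osc ε (S j x) := by
    funext x
    simp [wkbSum]
  rw [h]
  refine (eLpNorm_sum_le (fun j _ => (memLp_mul_osc (hA j) (hS j) ε).1) one_le_two).trans ?_
  refine Finset.sum_le_sum fun j _ => (eLpNorm_congr_norm_ae (Eventually.of_forall fun x => ?_)).le
  rw [norm_mul, norm_osc, mul_one, Complex.norm_real]

theorem integral_norm_sq_wkbSum_le (hA : ∀ j, MemLp (A j) 2 volume) (hS : ∀ j, Continuous (S j))
    (ε : ℝ) : ∫ x, ‖wkbSum A S ε x‖ ^ 2 ≤ N * ∑ j, ∫ x, (A j x) ^ 2 := by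
  have hi : ∀ j, Integrable (fun x => (A j x) ^ 2) volume := fun j => (hA j).integrable_sq
  rw [← integral_finsetSum _ fun j _ => hi j, ← integral_const_mul]
  refine integral_mono (memLp_wkbSum hA hS ε).norm.integrable_sq
    ((integrable_finsetSum _ fun j _ => hi j).const_mul _) fun x => ?_
  have h1 : ‖wkbSum A S ε x‖ ≤ ∑ j, |A j x| := (norm_sum_le _ _).trans_eq (by simp)
  have h2 := sq_sum_le_card_mul_sum_sq (s := Finset.univ) (f := fun j => |A j x|)
  simp only [sq_abs, Finset.card_univ, Fintype.card_fin] at h2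
  exact (pow_le_pow_left₀ (norm_nonneg _) h1 2).trans h2

theorem integral_norm_mul_norm_translate_le {f : Sp d → ℂ} (hf : MemLp f 2 volume) (w : Sp d) :
    ∫ x, ‖f (x - w)‖ * ‖f (x + w)‖ ≤ ∫ x, ‖f x‖ ^ 2 := by
  have hi : Integrable (fun x => ‖f x‖ ^ 2) volume := hf.norm.integrable_sq
  have h1 : Integrable (fun x => ‖f (x - w)‖ ^ 2) volume := hi.comp_sub_right w
  have h2 : Integrable (fun x => ‖f (x + w)‖ ^ 2) volume := hi.comp_add_right w
  have h3 : ∫ x, (‖f (x - w)‖ ^ 2 + ‖f (x + w)‖ ^ 2) / 2 = ∫ x, ‖f x‖ ^ 2 := by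
    rw [integral_div, integral_add h1 h2, integral_sub_right_eq_self (fun x => ‖f x‖ ^ 2) w,
      integral_add_right_eq_self (fun x => ‖f x‖ ^ 2) w]
    ring
  rw [← h3]
  refine integral_mono_of_nonneg (Eventually.of_forall fun x => by positivity)
    ((h1.add h2).div_const 2) (Eventually.of_forall fun x => ?_)
  beta_reduce
  nlinarith [sq_nonneg (‖f (x - w)‖ - ‖f (x + w)‖)]

theorem integrable_wkbSum {K : Set (Sp d)} (hK : IsCompact K) (hAK : ∀ j, ∀ x ∉ K, A j x = 0)
    (hA : ∀ j, MemLp (A j) 2 volume) (hS : ∀ j, Continuous (S j)) (ε : ℝ) :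
    Integrable (wkbSum A S ε) volume := by
  have : IsFiniteMeasure (volume.restrict K) := ⟨by simpa using hK.measure_lt_top⟩
  have h1 : IntegrableOn (wkbSum A S ε) K volume :=
    ((memLp_wkbSum hA hS ε).restrict K).integrable one_le_two
  refine (integrableOn_iff_integrable_of_support_subset fun x hx => ?_).1 h1
  by_contra hxK
  exact hx (by simp [wkbSum, hAK _ x hxK])

/-- At a fixed separation `εz` only the diagonal terms of the double sum over the branches
survive. -/
theorem tendsto_correlation_wkbSum {β : Sp d → ℂ} {M : ℝ}
    (hβ : AEStronglyMeasurable β volume) (hβM : ∀ x, ‖β x‖ ≤ M)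
    (hA : ∀ j, MemLp (A j) 2 volume) (hS : ∀ j, ContDiff ℝ 2 (S j)) {K : Set (Sp d)}
    (hK : IsClosed K) (hAK : ∀ j, ∀ x ∉ K, A j x = 0)
    (hne : ∀ j k, j ≠ k → ∀ x ∈ K, fderiv ℝ (S j) x ≠ fderiv ℝ (S k) x) (z : Sp d) :
    Tendsto (fun ε : ℝ => ∫ x, β x * (wkbSum A S ε (x - (ε / 2) • z) *
        (starRingEnd ℂ) (wkbSum A S ε (x + (ε / 2) • z)))) (𝓝[>] 0)
      (𝓝 (∑ j, ∫ x, correlationLimit β (A j) (A j) (S j) (S j) z x)) := by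
  have hS1 : ∀ j, ContDiff ℝ 1 (S j) := fun j => (hS j).of_le one_le_two
  have hlim : Tendsto (fun ε : ℝ => ∑ j, ∑ k, ∫ x, β x *
      ((A j (x - (ε / 2) • z) * osc ε (S j (x - (ε / 2) • z))) *
        (starRingEnd ℂ) (A k (x + (ε / 2) • z) * osc ε (S k (x + (ε / 2) • z))))) (𝓝[>] 0)
      (𝓝 (∑ j, ∑ k, if j = k then
        ∫ x, correlationLimit β (A j) (A j) (S j) (S j) z x else 0)) := by
    refine tendsto_finsetSum _ fun j _ => tendsto_finsetSum _ fun k _ => ?_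
    split_ifs with hjk
    · subst hjk
      exact tendsto_correlation_self hβ hβM (hA j) (hS1 j) z
    · exact tendsto_correlation_of_fderiv_ne hβ hβM (hA j) (hA k) (hS j) (hS k) hK (hAK j)
        (hne j k hjk) z
  simp only [Finset.sum_ite_eq, Finset.mem_univ, if_true] at hlim
  refine hlim.congr fun ε => ?_
  have hi : ∀ j k, Integrable (fun x => β x *
      ((A j (x - (ε / 2) • z) * osc ε (S j (x - (ε / 2) • z))) *
        (starRingEnd ℂ) (A k (x + (ε / 2) • z) * osc ε (S k (x + (ε / 2) • z))))) volume := by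
    intro j k
    have h1 : MemLp (fun x => (A j (x - (ε / 2) • z) : ℂ) * osc ε (S j (x - (ε / 2) • z))) 2
        volume := (memLp_mul_osc (hA j) (hS1 j).continuous ε).comp_measurePreserving
          (measurePreserving_sub_right volume ((ε / 2) • z))
    have h2 : MemLp (fun x => (A k (x + (ε / 2) • z) : ℂ) * osc ε (S k (x + (ε / 2) • z))) 2
        volume := (memLp_mul_osc (hA k) (hS1 k).continuous ε).comp_measurePreserving
          (measurePreserving_add_right volume ((ε / 2) • z))
    exact (h1.integrable_mul h2.star).bdd_mul hβ (Eventually.of_forall hβM)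
  have e : ∀ x, β x * (wkbSum A S ε (x - (ε / 2) • z) *
        (starRingEnd ℂ) (wkbSum A S ε (x + (ε / 2) • z))) = ∑ j, ∑ k, β x *
      ((A j (x - (ε / 2) • z) * osc ε (S j (x - (ε / 2) • z))) *
        (starRingEnd ℂ) (A k (x + (ε / 2) • z) * osc ε (S k (x + (ε / 2) • z)))) := fun x => by
    simp only [wkbSum]
    rw [map_sum, Finset.sum_mul_sum, Finset.mul_sum]
    simp_rw [Finset.mul_sum]
  simp_rw [e]
  rw [integral_finsetSum _ fun j _ => integrable_finsetSum _ fun k _ => hi j k]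
  congr 1
  funext j
  rw [integral_finsetSum _ fun k _ => hi j k]

/-- Undoing the partial Fourier transform in the limiting correlation: it evaluates the test
function on the graph of `∇s`. -/
theorem integral_integral_correlationLimit (a : 𝓢(Sp d × Sp d, ℂ)) {u s : Sp d → ℝ}
    (hu : MemLp u 2 volume) (hs : ContDiff ℝ 1 s) :
    Integrable (fun z => ∫ x, correlationLimit (fun x => partialFourier a x z) u u s s z x) ∧
    (((2 * Real.pi) ^ d)⁻¹ : ℝ) *
      ∫ z, ∫ x, correlationLimit (fun x => partialFourier a x z) u u s s z x =
      ∫ x, a (x, gradient s x) * ((u x ^ 2 : ℝ) : ℂ) := by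
  obtain ⟨B, hB, haB⟩ := exists_integrable_bound_partialFourier a
  have hgrad : ∀ x z, (fderiv ℝ s x z + fderiv ℝ s x z) / 2 = ⟪z, gradient s x⟫_ℝ := fun x z => by
    rw [add_self_div_two, gradient, real_inner_comm, InnerProductSpace.toDual_symm_apply]
  have e : ∀ x z, correlationLimit (fun x => partialFourier a x z) u u s s z x =
      ((u x ^ 2 : ℝ) : ℂ) * (partialFourier a x z *
        Complex.exp (-(Complex.I * ((⟪z, gradient s x⟫_ℝ : ℝ) : ℂ)))) := fun x z => by
    rw [correlationLimit, hgrad, ← sq]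
    ring
  have hgc : Continuous (gradient s) :=
    (InnerProductSpace.toDual ℝ (Sp d)).symm.continuous.comp (hs.continuous_fderiv one_ne_zero)
  have hint : Integrable (fun q : Sp d × Sp d => ((u q.1 ^ 2 : ℝ) : ℂ) *
      (partialFourier a q.1 q.2 *
        Complex.exp (-(Complex.I * ((⟪q.2, gradient s q.1⟫_ℝ : ℝ) : ℂ)))))
      (volume.prod volume) := by
    have hu2 : Integrable (fun x => u x ^ 2) volume := hu.integrable_sq
    refine (hu2.mul_prod hB).mono ?_ (Eventually.of_forall fun q => ?_)
    · refine (Complex.continuous_ofReal.comp_aestronglyMeasurable hu2.1).comp_fst.mul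
        ((stronglyMeasurable_partialFourier a).aestronglyMeasurable.mul ?_)
      exact Continuous.aestronglyMeasurable (by fun_prop)
    · rw [norm_mul, norm_mul, norm_mul, norm_exp_neg_I_mul, mul_one, Complex.norm_real]
      gcongr
      exact (haB _ _).trans (le_abs_self _)
  simp_rw [e]
  refine ⟨hint.integral_prod_right, ?_⟩
  rw [← integral_integral_swap hint, ← integral_const_mul]
  congr 1
  funext x
  rw [integral_const_mul, integral_partialFourier_mul_exp, mul_left_comm,
    ← mul_assoc (Complex.ofReal _) _ (a _),
    ← Complex.ofReal_mul, inv_mul_cancel₀ (by positivity), Complex.ofReal_one, one_mul, mul_comm]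

/-- The Wigner transforms of `∑_j A_j e^{iS_j/ε}` converge to `∑_j A_j² δ(ξ - ∇S_j)` when the
gradients `∇S_j` are pairwise distinct on the support of the amplitudes. -/
theorem tendsto_integral_mul_wigner_wkbSum (a : 𝓢(Sp d × Sp d, ℂ))
    (hA : ∀ j, MemLp (A j) 2 volume) (hS : ∀ j, ContDiff ℝ 2 (S j)) {K : Set (Sp d)}
    (hK : IsCompact K) (hAK : ∀ j, ∀ x ∉ K, A j x = 0)
    (hne : ∀ j k, j ≠ k → ∀ x ∈ K, fderiv ℝ (S j) x ≠ fderiv ℝ (S k) x) :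
    Tendsto (fun ε : ℝ => ∫ p : Sp d × Sp d,
        a p * wigner ε (wkbSum A S ε) (wkbSum A S ε) p.1 p.2) (𝓝[>] 0)
      (𝓝 (∑ j, ∫ x, a (x, gradient (S j) x) * ((A j x ^ 2 : ℝ) : ℂ))) := by
  have hS1 : ∀ j, ContDiff ℝ 1 (S j) := fun j => (hS j).of_le one_le_two
  have hS0 : ∀ j, Continuous (S j) := fun j => (hS j).continuous
  obtain ⟨B, hB, haB⟩ := exists_integrable_bound_partialFourier a
  have hL1 : ∀ ε, Integrable (wkbSum A S ε) volume := integrable_wkbSum hK hAK hA hS0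
  set M : ℝ := N * ∑ j, ∫ x, (A j x) ^ 2
  have hlim : Tendsto (fun ε : ℝ => ∫ z : Sp d, ∫ x : Sp d, partialFourier a x z *
        (wkbSum A S ε (x - (ε / 2) • z) * (starRingEnd ℂ) (wkbSum A S ε (x + (ε / 2) • z))))
      (𝓝[>] 0) (𝓝 (∫ z, ∑ j, ∫ x,
        correlationLimit (fun x => partialFourier a x z) (A j) (A j) (S j) (S j) z x)) := by
    refine tendsto_integral_filter_of_dominated_convergence (fun z => B z * M) ?_ ?_
      (hB.mul_const M) ?_
    · filter_upwards [self_mem_nhdsWithin] with ε hε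
      have h1 := (integrable_comp_sub_mul_comp_add (hL1 ε) (hL1 ε) (ne_of_gt hε)).1
      exact ((stronglyMeasurable_partialFourier a).aestronglyMeasurable.mul
        h1).prod_swap.integral_prod_right'
    · refine Eventually.of_forall fun ε => Eventually.of_forall fun z => ?_
      refine (norm_integral_le_integral_norm _).trans ?_
      have hf := memLp_wkbSum hA hS0 ε
      have h1 : Integrable (fun x => ‖wkbSum A S ε (x - (ε / 2) • z)‖ *
          ‖wkbSum A S ε (x + (ε / 2) • z)‖) volume :=
        (hf.comp_measurePreserving
          (measurePreserving_sub_right volume ((ε / 2) • z))).norm.integrable_mul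
          (hf.comp_measurePreserving (measurePreserving_add_right volume ((ε / 2) • z))).norm
      have hB0 : 0 ≤ B z := (norm_nonneg _).trans (haB 0 z)
      calc _ ≤ ∫ x, B z * (‖wkbSum A S ε (x - (ε / 2) • z)‖ *
              ‖wkbSum A S ε (x + (ε / 2) • z)‖) := by
            refine integral_mono_of_nonneg (Eventually.of_forall fun x => norm_nonneg _)
              (h1.const_mul _) (Eventually.of_forall fun x => ?_)
            beta_reduce
            rw [norm_mul, norm_mul, RCLike.norm_conj]
            gcongr
            exact haB x z
        _ ≤ B z * M := by
            rw [integral_const_mul]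
            gcongr
            exact (integral_norm_mul_norm_translate_le hf _).trans
              (integral_norm_sq_wkbSum_le hA hS0 ε)
    · refine Eventually.of_forall fun z => ?_
      refine tendsto_correlation_wkbSum (M := B z) ?_ (fun x => haB x z) hA hS hK.isClosed hAK hne z
      exact ((stronglyMeasurable_partialFourier a).comp_measurable
        (measurable_id.prodMk measurable_const)).aestronglyMeasurable
  have h2 := hlim.const_mul (((((2 * Real.pi) ^ d)⁻¹ : ℝ)) : ℂ)
  rw [integral_finsetSum _ fun j _ => (integral_integral_correlationLimit a (hA j) (hS1 j)).1,
    Finset.mul_sum] at h2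
  simp_rw [fun j => (integral_integral_correlationLimit a (hA j) (hS1 j)).2] at h2
  refine h2.congr' ?_
  filter_upwards [self_mem_nhdsWithin] with ε hε
  rw [integral_mul_wigner a (hL1 ε) (hL1 ε) (ne_of_gt hε)]

end Limit

/-! ### Finite measures as tempered distributions -/

/-- A finite measure is determined by the tempered distribution it defines: its characteristic
function is a limit of integrals of smoothly truncated characters. -/
theorem ext_of_forall_integral_schwartz_eq {E : Type*} [NormedAddCommGroup E] [NormedSpace ℝ E]
    [FiniteDimensional ℝ E] [MeasurableSpace E] [BorelSpace E] {μ ν : Measure E}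
    [IsFiniteMeasure μ] [IsFiniteMeasure ν]
    (h : ∀ a : 𝓢(E, ℂ), ∫ x, a x ∂μ = ∫ x, a x ∂ν) : μ = ν := by
  have : ProperSpace E := FiniteDimensional.proper_real E
  have : CompleteSpace E := FiniteDimensional.complete ℝ E
  refine Measure.ext_of_charFunDual (funext fun L => ?_)
  rw [charFunDual_apply, charFunDual_apply]
  let χ : ℕ → ContDiffBump (0 : E) := fun n => ⟨n + 1, n + 2, by positivity, by linarith⟩
  have hsm : ∀ n, ContDiff ℝ ∞ fun x => ((χ n x : ℝ) : ℂ) * Complex.exp (L x * Complex.I) :=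
    fun n => (Complex.ofRealCLM.contDiff.comp (χ n).contDiff).mul
      (((Complex.ofRealCLM.contDiff.comp L.contDiff).mul contDiff_const).cexp)
  have hcs : ∀ n, HasCompactSupport
      fun x => ((χ n x : ℝ) : ℂ) * Complex.exp (L x * Complex.I) := fun n =>
    ((χ n).hasCompactSupport.comp_left (g := fun r : ℝ => (r : ℂ)) Complex.ofReal_zero).mul_right
  have hlim : ∀ (κ : Measure E) [IsFiniteMeasure κ], Tendsto
      (fun n => ∫ x, ((χ n x : ℝ) : ℂ) * Complex.exp (L x * Complex.I) ∂κ) atTop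
      (𝓝 (∫ x, Complex.exp (L x * Complex.I) ∂κ)) := by
    intro κ _
    refine tendsto_integral_of_dominated_convergence (fun _ => 1)
      (fun n => (hsm n).continuous.aestronglyMeasurable) (integrable_const 1)
      (fun n => Eventually.of_forall fun x => ?_) (Eventually.of_forall fun x => ?_)
    · rw [norm_mul, Complex.norm_exp_ofReal_mul_I, mul_one, Complex.norm_real,
        Real.norm_of_nonneg (χ n).nonneg]
      exact (χ n).le_one
    · refine tendsto_const_nhds.congr' ?_
      filter_upwards [eventually_ge_atTop ⌈‖x‖⌉₊] with n hn
      have hx : x ∈ Metric.closedBall (0 : E) (χ n).rIn := by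
        rw [mem_closedBall_zero_iff]
        have h1 : ‖x‖ ≤ n := (Nat.le_ceil _).trans (by exact_mod_cast hn)
        change ‖x‖ ≤ (n : ℝ) + 1
        linarith
      rw [(χ n).one_of_mem_closedBall hx, Complex.ofReal_one, one_mul]
  refine tendsto_nhds_unique (hlim μ) ((hlim ν).congr fun n => ?_)
  exact (h ((hcs n).toSchwartzMap (hsm n))).symm

/-! ### Densities carried by graphs -/

theorem withDensity_map {X Y : Type*} [MeasurableSpace X] [MeasurableSpace Y] {ν : Measure X}
    {w : X → Y} (hw : AEMeasurable w ν) {G : Y → ℝ≥0∞} (hG : Measurable G) :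
    (ν.map w).withDensity G = (ν.withDensity fun x => G (w x)).map w := by
  ext s hs
  rw [withDensity_apply _ hs, Measure.map_apply_of_aemeasurable
    (hw.mono_ac (withDensity_absolutelyContinuous _ _)) hs,
    Measure.restrict_map_of_aemeasurable hw hs, lintegral_map' hG.aemeasurable hw.restrict,
    withDensity_apply₀]
  exact hw.nullMeasurableSet_preimage hs

/-- The multiphase measure with density `φ²` is the sum over the branches of the images of
`A_i(x)² dx`, with `A_i = φ √n_i`, on the graphs of `∇_x S_i`. -/
theorem withDensity_multiphaseMeasure {N : ℕ} {F : ℝ → Sp d × Sp d → Sp d × Sp d}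
    {g : Sp d → Sp d} {nI : Sp d → ℝ} {U : Set (Sp d × ℝ)} {S : Fin N → Sp d → ℝ → ℝ} {t : ℝ}
    {φ : Sp d × ℝ → ℝ} (hφ : Continuous φ)
    (hw : ∀ i, AEMeasurable (fun x => gradX (S i) x t) (volume.restrict {x | (x, t) ∈ U}))
    (hn : ∀ i, AEMeasurable (fun x => branchDensity F g nI x t (gradX (S i) x t))
      (volume.restrict {x | (x, t) ∈ U})) :
    (multiphaseMeasure F g nI U S t).withDensity (fun p => ENNReal.ofReal (φ (p.1, t) ^ 2)) =
      ∑ i, ((volume.restrict {x | (x, t) ∈ U}).withDensity (fun x => ENNReal.ofReal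
        ((φ (x, t) * Real.sqrt (branchDensity F g nI x t (gradX (S i) x t))) ^ 2))).map
          (fun x => (x, gradX (S i) x t)) := by
  have hG : Measurable fun p : Sp d × Sp d => ENNReal.ofReal (φ (p.1, t) ^ 2) :=
    (Continuous.measurable (by fun_prop)).ennreal_ofReal
  have hG' : Measurable fun x : Sp d => ENNReal.ofReal (φ (x, t) ^ 2) :=
    (Continuous.measurable (by fun_prop)).ennreal_ofReal
  rw [multiphaseMeasure, ← Measure.sum_fintype, withDensity_sum, Measure.sum_fintype]
  refine Finset.sum_congr rfl fun i _ => ?_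
  rw [withDensity_map (aemeasurable_id'.prodMk ((hw i).mono_ac
    (withDensity_absolutelyContinuous _ _))) hG,
    ← withDensity_mul₀ (hn i).ennreal_ofReal hG'.aemeasurable]
  congr 2
  funext x
  -- for a negative density both sides vanish
  rw [Pi.mul_apply, mul_pow, ENNReal.ofReal_mul (sq_nonneg _), mul_comm]
  congr 1
  rcases le_total 0 (branchDensity F g nI x t (gradX (S i) x t)) with h | h
  · rw [Real.sq_sqrt h]
  · rw [Real.sqrt_eq_zero_of_nonpos h, ENNReal.ofReal_of_nonpos h]
    simp

/-- Integration against a density `u² dx` transported to the graph of `w`. -/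
theorem integral_map_graph_withDensity {V : Set (Sp d)} {u : Sp d → ℝ}
    {w : Sp d → Sp d} (hu : AEMeasurable u (volume.restrict V))
    (hw : AEMeasurable w (volume.restrict V)) (huV : ∀ x ∉ V, u x = 0) {a : Sp d × Sp d → ℂ}
    (ha : Continuous a) :
    ∫ p, a p ∂(((volume.restrict V).withDensity (fun x => ENNReal.ofReal (u x ^ 2))).map
      (fun x => (x, w x))) = ∫ x, a (x, w x) * ((u x ^ 2 : ℝ) : ℂ) := by
  rw [integral_map ((aemeasurable_id'.prodMk hw).mono_ac (withDensity_absolutelyContinuous _ _))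
    ha.aestronglyMeasurable, integral_withDensity_eq_integral_toReal_smul₀
    (hu.pow_const 2).ennreal_ofReal (Eventually.of_forall fun x => ENNReal.ofReal_lt_top),
    ← setIntegral_eq_integral_of_forall_compl_eq_zero (s := V)
      (f := fun x => a (x, w x) * ((u x ^ 2 : ℝ) : ℂ))]
  · congr 1
    funext x
    rw [ENNReal.toReal_ofReal (sq_nonneg _), Complex.real_smul, mul_comm]
  · intro x hx
    simp [huV x hx]

/-- `IsWignerMeasure` determines the measure. -/
theorem IsWignerMeasure.unique {l : Filter ℝ} [l.NeBot] {f : ℝ → Sp d → ℂ}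
    {μ ν : Measure (Sp d × Sp d)} (hμ : IsWignerMeasure l f μ) (hν : IsWignerMeasure l f ν) :
    μ = ν := by
  have := hμ.finite
  have := hν.finite
  exact ext_of_forall_integral_schwartz_eq fun a =>
    tendsto_nhds_unique (hμ.tendsto a) (hν.tendsto a)

theorem IsWignerMeasure.mono {l l' : Filter ℝ} {f : ℝ → Sp d → ℂ}
    {μ : Measure (Sp d × Sp d)} (h : IsWignerMeasure l f μ) (hl : l' ≤ l) :
    IsWignerMeasure l' f μ where
  finite := h.finite
  memLp := h.memLp.filter_mono hl
  bounded := h.bounded.imp fun _ hC => hC.filter_mono hl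
  tendsto a := (h.tendsto a).mono_left hl

/-! ### The Wigner measure of the multiphase WKB function -/

theorem contDiffOn_gradient {E : Type*} [NormedAddCommGroup E] [InnerProductSpace ℝ E]
    [CompleteSpace E] {s : E → ℝ} {V : Set E} (hV : IsOpen V) (hs : ContDiffOn ℝ 2 s V) :
    ContDiffOn ℝ 1 (gradient s) V :=
  (InnerProductSpace.toDual ℝ E).symm.contDiff.comp_contDiffOn
    (hs.fderiv_of_isOpen hV (by norm_num [one_add_one_eq_two]))

end WignerWKB

open WignerWKB
theorem corollary4p2 (d : ℕ)
    -- (A1): the Hamiltonian is a symbol, its quantization is essentially self-adjoint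
    (H : Sp d → Sp d → ℝ) (hsymbol : ∃ σ : ℝ, IsSymbol σ H)
    (ε₀ : ℝ) (hε₀ : 0 < ε₀)
    (hsa : ∀ ε : ℝ, 0 < ε → ε ≤ ε₀ → HasUniqueSelfAdjointExtension H ε)
    -- (A2): initial density and initial phase, with (weak) gradient `g = ∇ S_I`
    (nI : Sp d → ℝ) (hnI : Integrable nI volume) (hnI_nonneg : ∀ᵐ x, 0 ≤ nI x)
    (SI : Sp d → ℝ) (g : Sp d → Sp d) (hSI : IsWeakGradient SI g)
    -- (A3): global continuously differentiable Hamiltonian flow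
    (F : ℝ → Sp d × Sp d → Sp d × Sp d) (hF : IsHamiltonianFlow H F)
    -- (A4): over the open set `U` the nullset has exactly `N` elements `v_1, …, v_N`
    (U : Set (Sp d × ℝ)) (hU : IsOpen U) (N : ℕ) (v : Fin N → Sp d → ℝ → Sp d)
    (hv_inj : ∀ x t, (x, t) ∈ U → Function.Injective (fun i => v i x t))
    (hv : ∀ x t, (x, t) ∈ U → nullset F g x t = ⋃ i, {v i x t})
    -- over `U`, `f_{x,t}(ξ)` is continuously differentiable in `(x, ξ)`
    (hf : ∀ t, ContDiffOn ℝ 1 (fun q : Sp d × Sp d => branchMap F g q.1 t q.2)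
      {q | (q.1, t) ∈ U})
    -- no caustics in `U`
    (hcaustic : U ∩ causticSet F g = ∅)
    -- the phases of the branches
    (S : Fin N → Sp d → ℝ → ℝ)
    (hS : ∀ i, ContDiffOn ℝ 2 (fun p : Sp d × ℝ => S i p.1 p.2) U)
    (hSv : ∀ i x t, (x, t) ∈ U → gradX (S i) x t = v i x t)
    -- the cutoff
    (φ : Sp d × ℝ → ℝ) (hφ : ContDiff ℝ ∞ φ) (hφc : HasCompactSupport φ)
    (hφU : tsupport φ ⊆ U) (t : ℝ) :
    -- the Wigner measure is `φ²` times the multiphase measure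
    IsWignerMeasure (𝓝[>] (0 : ℝ))
      (fun ε x => (φ (x, t) : ℂ) * psiWKB F g nI S ε x t)
      ((multiphaseMeasure F g nI U S t).withDensity
        (fun p => ENNReal.ofReal (φ (p.1, t) ^ 2))) ∧
    -- and it is the only one, along every sequence of scales tending to `0`
    ∀ e : ℕ → ℝ, Tendsto e atTop (𝓝[>] (0 : ℝ)) → ∀ μ : Measure (Sp d × Sp d),
      IsWignerMeasure (Filter.map e atTop)
        (fun ε x => (φ (x, t) : ℂ) * psiWKB F g nI S ε x t) μ →
      μ = (multiphaseMeasure F g nI U S t).withDensity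
        (fun p => ENNReal.ofReal (φ (p.1, t) ^ 2)) := by

  have hHs : ContDiff ℝ ∞ (fun p : Sp d × Sp d => H p.1 p.2) := hsymbol.choose_spec.1
  have hFF : ∀ p, F t (F (-t) p) = p := hF.apply_neg hHs t
  have hFF' : ∀ p, F (-t) (F t p) = p := fun p => by simpa using hF.apply_neg hHs (-t) p
  set V : Set (Sp d) := {x | (x, t) ∈ U}
  have hVo : IsOpen V := hU.preimage (by fun_prop : Continuous fun x : Sp d => (x, t))
  have hφt : Continuous fun x : Sp d => φ (x, t) := by
    have := hφ.continuous
    fun_prop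
  set K : Set (Sp d) := {x | (x, t) ∈ tsupport φ}
  have hK : IsCompact K := by
    refine (hφc.isCompact.image continuous_fst).of_isClosed_subset
      ((isClosed_tsupport φ).preimage (by fun_prop : Continuous fun x : Sp d => (x, t))) ?_
    exact fun x hx => ⟨(x, t), hx, rfl⟩
  have hKV : K ⊆ V := fun x hx => hφU hx
  have hφK : ∀ x ∉ K, φ (x, t) = 0 := fun x hx => image_eq_zero_of_notMem_tsupport hx
  have hSV : ∀ i, ContDiffOn ℝ 2 (fun x => S i x t) V := fun i =>
    (hS i).comp (contDiff_prodMk_left t).contDiffOn fun x hx => hx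
  have hwV : ∀ i, ContDiffOn ℝ 1 (fun x => gradX (S i) x t) V := fun i =>
    contDiffOn_gradient hVo (hSV i)
  have hnull : ∀ i, ∀ x ∈ V, gradX (S i) x t ∈ nullset F g x t := fun i x hx => by
    rw [hv x t hx, hSv i x t hx]
    exact mem_iUnion.2 ⟨i, rfl⟩
  have hdet : ∀ i, ∀ x ∈ V, branchDet F g x t (gradX (S i) x t) ≠ 0 := fun i x hx h0 => by
    have : (x, t) ∈ U ∩ causticSet F g := ⟨hx, _, hnull i x hx, h0⟩
    rw [hcaustic] at this
    exact this
  -- on `K` the densities are integrable, so the amplitudes `A i = φ √n_i` are square integrable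
  have hloc : ∀ i, LocallyIntegrableOn
      (fun x => branchDensity F g nI x t (gradX (S i) x t)) V volume := fun i =>
    locallyIntegrableOn_branchDensity hnI hVo hFF hFF' ((hF.contDiff t).differentiable one_ne_zero)
      (hF.contDiff (-t)) (hnull i) (hwV i) (hf t) (hdet i)
  have hn : ∀ i, AEMeasurable (fun x => branchDensity F g nI x t (gradX (S i) x t))
      (volume.restrict V) := fun i => (hloc i).aestronglyMeasurable.aemeasurable
  have hw : ∀ i, AEMeasurable (fun x => gradX (S i) x t) (volume.restrict V) := fun i =>
    (hwV i).continuousOn.aemeasurable hVo.measurableSet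
  set A : Fin N → Sp d → ℝ := fun i x =>
    φ (x, t) * Real.sqrt (branchDensity F g nI x t (gradX (S i) x t))
  have hAK : ∀ i, ∀ x ∉ K, A i x = 0 := fun i x hx => by simp [A, hφK x hx]
  have hAV : ∀ i, ∀ x ∉ V, A i x = 0 := fun i x hx => hAK i x fun h => hx (hKV h)
  have hAm : ∀ i, AEMeasurable (A i) (volume.restrict V) := fun i =>
    hφt.measurable.aemeasurable.mul (hn i).sqrt
  have hA : ∀ i, MemLp (A i) 2 volume := fun i => by
    have hAm' : AEStronglyMeasurable (A i) volume := by
      have h1 : V.indicator (A i) = A i := by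
        funext x
        by_cases hx : x ∈ V
        · rw [indicator_of_mem hx]
        · rw [indicator_of_notMem hx, hAV i x hx]
      rw [← h1, aestronglyMeasurable_indicator_iff hVo.measurableSet]
      exact (hAm i).aestronglyMeasurable
    rw [memLp_two_iff_integrable_sq hAm']
    refine (integrableOn_iff_integrable_of_support_subset (s := K) fun x hx => ?_).1 ?_
    · by_contra hxK
      exact hx (by simp [hAK i x hxK])
    · have h1 : IntegrableOn (fun x => φ (x, t) ^ 2 *
          branchDensity F g nI x t (gradX (S i) x t)) K volume :=
        ((hloc i).integrableOn_compact_subset hKV hK).continuousOn_mul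
          (hφt.pow 2).continuousOn hK
      refine Integrable.mono h1 (hAm'.pow 2).restrict (Eventually.of_forall fun x => ?_)
      simp only [A, mul_pow, norm_mul]
      gcongr
      rw [norm_pow, Real.norm_of_nonneg (Real.sqrt_nonneg _), Real.sq_sqrt']
      exact max_le (le_abs_self _) (norm_nonneg _)
  -- replace the phases by globally smooth ones that agree with them near the support of `φ`
  obtain ⟨χ, hχ, hχ1, hχV, -⟩ := exists_contDiff_cutoff hK.isClosed hVo hKV
  set s : Fin N → Sp d → ℝ := fun i x => χ x * S i x t
  have hs : ∀ i, ContDiff ℝ 2 (s i) := fun i => contDiff_iff_contDiffAt.2 fun x => by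
    by_cases hx : x ∈ tsupport χ
    · exact (contDiff_infty.1 hχ 2).contDiffAt.mul
        ((hSV i).contDiffAt (hVo.mem_nhds (hχV hx)))
    · refine contDiffAt_const (c := (0 : ℝ)) |>.congr_of_eventuallyEq ?_
      filter_upwards [notMem_tsupport_iff_eventuallyEq.1 hx] with y hy
      simp [s, hy]
  have hsS : ∀ i, ∀ x ∈ K, s i =ᶠ[𝓝 x] fun y => S i y t := fun i x hx => by
    filter_upwards [eventually_nhdsSet_iff_forall.1 hχ1 x hx] with y hy
    simp [s, hy]
  have hgrad : ∀ i, ∀ x ∈ K, gradient (s i) x = gradX (S i) x t := fun i x hx => by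
    rw [gradX, gradient, gradient, (hsS i x hx).fderiv_eq]
  have hne : ∀ j k, j ≠ k → ∀ x ∈ K, fderiv ℝ (s j) x ≠ fderiv ℝ (s k) x := by
    intro j k hjk x hx h
    refine hjk (hv_inj x t (hKV hx) ?_)
    change v j x t = v k x t
    rw [← hSv j x t (hKV hx), ← hSv k x t (hKV hx), ← hgrad j x hx, ← hgrad k x hx,
      gradient, gradient, h]
  have hψ : (fun (ε : ℝ) (x : Sp d) => (φ (x, t) : ℂ) * psiWKB F g nI S ε x t) = wkbSum A s := by
    funext ε x
    by_cases hx : x ∈ K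
    · rw [psiWKB, wkbSum, Finset.mul_sum]
      refine Finset.sum_congr rfl fun i _ => ?_
      rw [(hsS i x hx).self_of_nhds, osc, ← mul_assoc, Complex.ofReal_mul]
    · simp [wkbSum, hφK x hx, hAK _ x hx]
  have hs0 : ∀ i, Continuous (s i) := fun i => (hs i).continuous
  have hfin : ∀ i, IsFiniteMeasure (((volume.restrict V).withDensity
      (fun x => ENNReal.ofReal (A i x ^ 2))).map (fun x => (x, gradX (S i) x t))) := fun i => by
    have := isFiniteMeasure_withDensity_ofReal (hA i).integrable_sq.integrableOn.2 (μ :=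
      volume.restrict V)
    infer_instance
  have hmain : IsWignerMeasure (𝓝[>] (0 : ℝ))
      (fun ε x => (φ (x, t) : ℂ) * psiWKB F g nI S ε x t)
      ((multiphaseMeasure F g nI U S t).withDensity
        (fun p => ENNReal.ofReal (φ (p.1, t) ^ 2))) := by
    rw [hψ, withDensity_multiphaseMeasure hφ.continuous hw hn]
    refine ⟨inferInstance, Eventually.of_forall (memLp_wkbSum hA hs0),
      ⟨_, Eventually.of_forall (eLpNorm_wkbSum_le hA hs0)⟩, fun a => ?_⟩
    rw [integral_finsetSum_measure fun i _ => a.integrable]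
    have h := tendsto_integral_mul_wigner_wkbSum a hA hs hK hAK hne
    refine h.trans_eq (congrArg 𝓝 (Finset.sum_congr rfl fun i _ => ?_))
    rw [integral_map_graph_withDensity (hAm i) (hw i) (hAV i) a.continuous]
    congr 1
    funext x
    by_cases hx : x ∈ K
    · rw [hgrad i x hx]
    · simp [hAK i x hx]
  exact ⟨hmain, fun e he μ hμ => hμ.unique (hmain.mono he)⟩
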